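/- Let $d\ge 1$ and let $(Z_i)_{i\in\mathbb Z}$ be i.i.d. random vectors in $\mathbb R^d$ with zero mean that are regularly varying with exponent $\alpha>1$ and tail measure $\nu$. That is, $P(\|Z_0\|>u)>0$ for all $u$, and $\nu$ is a Radon measure on $[-\infty,\infty]^d\setminus\{0\}$ such that $P(Z_0\in u\,\cdot)/P(\|Z_0\|>u)$ converges vaguely to $\nu$ on $[-\infty,\infty]^d\setminus\{0\}$ as $u\to\infty$, and $\nu(c\Phi)=c^{-\alpha}\nu(\Phi)$ for all $c>0$ and all measurable $\Phi\subset[-\infty,\infty]^d\setminus\{0\}$. Let $(A_i)_{i\in\mathbb Z}$ be deterministic real $d\times d$ matrices such that $\sum_{i\in\mathbb Z}\|A_i\|<\infty$ ($\ell_2/\ell_2$ operator norm) and such that $\mathcal A=\sum_{i\in\mathbb Z}A_i$ is invertible. Put $$X_k=\sum_{i\in\mathbb Z}A_iZ_{k-i},\qquad S_j^n=\sum_{k=j}^{n+j-1}X_k\qquad(j,k\in\mathbb Z,\ n\ge 1);$$ the series converge almost surely. Let $\Gamma\subset\mathbb R^d$ be a measurable set that is bounded away from the origin (for some $\delta_0>0$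 it is disjoint from the closed ball of radius $\delta_0$ centered at $0$) and satisfies $$\nu(\mathcal A^{-1}\Gamma)>0,\qquad \nu\bigl(\partial(\mathcal A^{-1}\Gamma)\bigr)=0 .$$ Then $P(\mathcal AZ_0\in n\Gamma)>0$ for all large $n$, and for every $0\le\theta<1$, $$\lim_{n\to\infty}\frac{P\Bigl(\bigl\{S_j^n\in n\Gamma\text{ for all integers }0\le j\le n\theta\bigr\}\,\triangle\,\bigl\{\mathcal AZ_i\in n\Gamma\text{ for some }i\in\{\lfloor n\theta\rfloor,\dots,n-1\}\bigr\}\Bigr)}{n\,P(\mathcal AZ_0\in n\Gamma)}=0 .$$ -/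

import Mathlib

open MeasureTheory ProbabilityTheory Filter Topology
open scoped ENNReal Pointwise symmDiff

noncomputable section

namespace MovingAverage

/-- The space `ℝ^d` of (column) vectors with the Euclidean norm. -/
abbrev Vec (d : ℕ) : Type := EuclideanSpace ℝ (Fin d)

/-- The matrix `A` acting on vectors, as a continuous linear map of Euclidean space. Its norm is
the `ℓ²/ℓ²` operator norm of `A`. -/
abbrev act {d : ℕ} (A : Matrix (Fin d) (Fin d) ℝ) : Vec d →L[ℝ] Vec d :=
  Matrix.toEuclideanCLM (n := Fin d) (𝕜 := ℝ) A

/-! ### Multivariate regular variation -/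

/-- The punctured compactified space `[-∞, ∞]^d \ {0}`, with the subspace topology of the product
topology and its Borel sets. Its relatively compact sets are those bounded away from `0`. -/
abbrev Punctured (d : ℕ) : Type := {x : Fin d → EReal // x ≠ 0}

/-- The inclusion of `ℝ^d` into `[-∞, ∞]^d`. -/
def toExt {d : ℕ} (x : Vec d) : Fin d → EReal := fun i => ((x i : ℝ) : EReal)

/-- A set of vectors `S ⊆ ℝ^d`, seen inside `[-∞, ∞]^d \ {0}` (the origin is dropped). -/
def inPunctured {d : ℕ} (S : Set (Vec d)) : Set (Punctured d) :=
  {x | ∃ y ∈ S, x.1 = toExt y}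

/-- The dilated set `c Φ` for `Φ ⊆ [-∞, ∞]^d \ {0}`. -/
def dilate {d : ℕ} (c : ℝ) (Φ : Set (Punctured d)) : Set (Punctured d) :=
  {x | ∃ y ∈ Φ, ∀ i, x.1 i = (c : EReal) * y.1 i}

/-- The measure `P(Y ∈ u ·)` on `[-∞, ∞]^d \ {0}`: the law of `Y / u` restricted to that space. -/
def scaledLaw {Ω : Type*} [MeasurableSpace Ω] {d : ℕ} (P : Measure Ω) (Y : Ω → Vec d) (u : ℝ) :
    Measure (Punctured d) :=
  (P.map (fun ω => toExt (u⁻¹ • Y ω))).comap Subtype.val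

/-- Vague convergence of measures: convergence of the integrals of all continuous functions with
compact support. -/
def VagueTendsto {T E : Type*} [TopologicalSpace E] [MeasurableSpace E]
    (m : T → Measure E) (l : Filter T) (ν : Measure E) : Prop :=
  ∀ f : E → ℝ, Continuous f → HasCompactSupport f →
    Tendsto (fun t => ∫ x, f x ∂(m t)) l (𝓝 (∫ x, f x ∂ν))

/-- `Y ∈ RV(ν, α)`: the random vector `Y` is regularly varying with tail measure `ν` and
exponent `α`. -/
structure RegularlyVarying {Ω : Type*} [MeasurableSpace Ω] {d : ℕ} (P : Measure Ω)
    (Y : Ω → Vec d) (ν : Measure (Punctured d)) (α : ℝ) : Prop where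
  /-- `ν` is a Radon measure. On this locally compact, second countable Hausdorff space it means
  that `ν` is a Borel measure that is finite on compact sets. -/
  radon : IsFiniteMeasureOnCompacts ν
  /-- The normalizing probabilities do not vanish. -/
  tail_pos : ∀ u : ℝ, 0 < P {ω | u < ‖Y ω‖}
  /-- `P(Y ∈ u ·) / P(‖Y‖ > u)` converges vaguely to `ν` as `u → ∞`. -/
  vague : VagueTendsto (fun u : ℝ => (P {ω | u < ‖Y ω‖})⁻¹ • scaledLaw P Y u) atTop ν
  /-- `ν (c Φ) = c ^ (-α) ν (Φ)`. -/
  homogeneous : ∀ c : ℝ, 0 < c → ∀ Φ : Set (Punctured d), MeasurableSet Φ →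
    ν (dilate c Φ) = ENNReal.ofReal (c ^ (-α)) * ν Φ

/-! ### The moving average process -/

/-- The sum `𝒜 = ∑_{i ∈ ℤ} A_i` of the coefficient matrices. -/
def coeffSum {d : ℕ} (A : ℤ → Matrix (Fin d) (Fin d) ℝ) : Matrix (Fin d) (Fin d) ℝ :=
  ∑' i : ℤ, A i

/-- The moving average `X_k = ∑_{i ∈ ℤ} A_i Z_{k-i}`. -/
def movAvg {Ω : Type*} {d : ℕ} (A : ℤ → Matrix (Fin d) (Fin d) ℝ) (Z : ℤ → Ω → Vec d)
    (k : ℤ) (ω : Ω) : Vec d :=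
  ∑' i : ℤ, act (A i) (Z (k - i) ω)

/-- The sum `S_j^n = X_j + ⋯ + X_{n+j-1}`. -/
def blockSum {Ω : Type*} {d : ℕ} (A : ℤ → Matrix (Fin d) (Fin d) ℝ) (Z : ℤ → Ω → Vec d)
    (j : ℤ) (n : ℕ) (ω : Ω) : Vec d :=
  ∑ k ∈ Finset.Icc j (n + j - 1), movAvg A Z k ω

/-- The assumptions on the failure set `Γ`, where `M` is the matrix `𝒜`: it is measurable, bounded
away from the origin, `ν (M⁻¹ Γ) > 0` and `ν (∂ (M⁻¹ Γ)) = 0`. -/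
structure IsFailureSet {d : ℕ} (ν : Measure (Punctured d)) (M : Matrix (Fin d) (Fin d) ℝ)
    (Γ : Set (Vec d)) : Prop where
  measurable : MeasurableSet Γ
  bounded_away : ∃ δ : ℝ, 0 < δ ∧ Γ ⊆ (Metric.closedBall 0 δ)ᶜ
  pos : 0 < ν (inPunctured (act M ⁻¹' Γ))
  continuity : ν (inPunctured (frontier (act M ⁻¹' Γ))) = 0

/-- The event `{S_j^n ∈ nΓ for all integers 0 ≤ j ≤ nθ}`. -/
def rareRun {Ω : Type*} {d : ℕ} (A : ℤ → Matrix (Fin d) (Fin d) ℝ) (Z : ℤ → Ω → Vec d)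
    (Γ : Set (Vec d)) (θ : ℝ) (n : ℕ) : Set Ω :=
  {ω | ∀ j : ℤ, 0 ≤ j → (j : ℝ) ≤ n * θ → blockSum A Z j n ω ∈ (n : ℝ) • Γ}

/-- The event `{𝒜 Z_i ∈ nΓ for some i ∈ {⌊nθ⌋, …, n - 1}}`. -/
def bigJump {Ω : Type*} {d : ℕ} (A : ℤ → Matrix (Fin d) (Fin d) ℝ) (Z : ℤ → Ω → Vec d)
    (Γ : Set (Vec d)) (θ : ℝ) (n : ℕ) : Set Ω :=
  {ω | ∃ i : ℤ, ⌊(n : ℝ) * θ⌋ ≤ i ∧ i ≤ (n : ℤ) - 1 ∧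
    act (coeffSum A) (Z i ω) ∈ (n : ℝ) • Γ}

end MovingAverage

end

/-! The principle is that of a single big jump. Write `S_j^n = ∑_i B_{j,i} Z_i` with `B_{j,i} =
∑_{k=j}^{n+j-1} A_{k-i}` (`blockCoef`). These coefficients are close to `𝒜` for `i` deep inside the
block, and their total norm outside the block is `o(n)`. With heavy tails, a sum of order `n` comes
from one innovation of order `n` inside the block, up to probability `o(n p_n)`, where `p_n =
P(‖Z_0‖ > n)`.

Put `J = ⌊nθ⌋`. If `S_0^n` and `S_J^n` both lie in `nΓ`, each block contains a jump. Two distinct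
jumps cost `O((n p_n)^2)`, and `n p_n → 0`, so the jump is common and sits at some `i` in `[J,
n-1]`. This index belongs to every block with `0 ≤ j ≤ J`, so all these sums are close to `𝒜 Z_i` at
once. They are in `nΓ` exactly when `𝒜 Z_i` is, unless `Z_i / n` is near the boundary of `𝒜⁻¹Γ`,
which `ν` does not charge. `rareRun_symmDiff_bigJump_subset` is this argument as a deterministic
inclusion.

The exceptional events are bounded as follows. `prob_no_jump_le` combines a Chernoff bound for
truncated sums, small beyond any power of `n`, with the polynomial lower bound on the tail and a
Potter bound for innovations outside the block. `prob_jump_and_rest_le` uses independence of the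
jump from the remaining sum. `exists_prob_cthickening_le` handles the boundary. Finally
`IsFailureSet.exists_le_prob` shows that `P(𝒜 Z_0 ∈ nΓ)` is at least of order `p_n`, so `o(n p_n)`
suffices. -/

namespace MovingAverage

/-! ### Vague convergence and scaling of the norm tail -/

section RegularVariation

variable {Ω : Type*} [MeasurableSpace Ω] {P : Measure Ω} [IsProbabilityMeasure P] {d : ℕ}
  {Y : Ω → Vec d} {ν : Measure (Punctured d)} {α : ℝ}

/-- The tail probability `P(‖Y‖ > u)`. -/
noncomputable def tailProb (P : Measure Ω) (Y : Ω → Vec d) (u : ℝ) : ℝ := P.real {ω | u < ‖Y ω‖}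

lemma tailProb_nonneg (P : Measure Ω) (Y : Ω → Vec d) (u : ℝ) : 0 ≤ tailProb P Y u :=
  measureReal_nonneg

lemma RegularlyVarying.tailProb_pos (h : RegularlyVarying P Y ν α) (u : ℝ) :
    0 < tailProb P Y u :=
  ENNReal.toReal_pos (h.tail_pos u).ne' (measure_ne_top _ _)

lemma tailProb_anti : Antitone (tailProb P Y) := fun _ _ h =>
  measureReal_mono fun _ hω => lt_of_le_of_lt h hω

lemma isOpenEmbedding_toExt : IsOpenEmbedding (toExt (d := d)) :=
  (IsOpenEmbedding.piMap fun _ : Fin d => EReal.isOpenEmbedding_coe).comp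
    (EuclideanSpace.equiv (Fin d) ℝ).toHomeomorph.isOpenEmbedding

lemma toExt_zero : toExt (0 : Vec d) = 0 := by
  ext i; simp [toExt]

lemma image_val_inPunctured {S : Set (Vec d)} (h : (0 : Vec d) ∉ S) :
    Subtype.val '' inPunctured S = toExt '' S := by
  ext x
  constructor
  · rintro ⟨x, ⟨y, hy, hxy⟩, rfl⟩
    exact ⟨y, hy, hxy.symm⟩
  · rintro ⟨y, hy, rfl⟩
    refine ⟨⟨toExt y, fun h0 => h ?_⟩, ⟨y, hy, rfl⟩, rfl⟩
    rw [← toExt_zero] at h0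
    rwa [isOpenEmbedding_toExt.injective h0] at hy

lemma isCompact_inPunctured {S : Set (Vec d)} (hS : IsCompact S) (h : (0 : Vec d) ∉ S) :
    IsCompact (inPunctured S) := by
  rw [Subtype.isCompact_iff, image_val_inPunctured h]
  exact hS.image isOpenEmbedding_toExt.continuous

lemma isOpen_inPunctured {S : Set (Vec d)} (hS : IsOpen S) : IsOpen (inPunctured S) := by
  have : inPunctured S = Subtype.val ⁻¹' (toExt '' S) := by
    ext x
    exact ⟨fun ⟨y, hy, e⟩ => ⟨y, hy, e.symm⟩, fun ⟨y, hy, e⟩ => ⟨y, hy, e.symm⟩⟩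
  rw [this]
  exact (isOpenEmbedding_toExt.isOpenMap _ hS).preimage continuous_subtype_val

lemma inPunctured_mono {S T : Set (Vec d)} (h : S ⊆ T) : inPunctured S ⊆ inPunctured T :=
  fun _ ⟨y, hy, e⟩ => ⟨y, h hy, e⟩

lemma inPunctured_iUnion {ι : Sort*} (S : ι → Set (Vec d)) :
    inPunctured (⋃ i, S i) = ⋃ i, inPunctured (S i) := by
  ext x
  simp only [inPunctured, Set.mem_iUnion, Set.mem_ofPred_eq]
  exact ⟨fun ⟨y, ⟨i, hi⟩, e⟩ => ⟨i, y, hi, e⟩, fun ⟨i, y, hi, e⟩ => ⟨y, ⟨i, hi⟩, e⟩⟩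

lemma inPunctured_iInter {ι : Type*} [Nonempty ι] (S : ι → Set (Vec d)) :
    inPunctured (⋂ i, S i) = ⋂ i, inPunctured (S i) := by
  ext x
  simp only [inPunctured, Set.mem_iInter, Set.mem_ofPred_eq]
  refine ⟨fun ⟨y, h, e⟩ i => ⟨y, h i, e⟩, fun h => ?_⟩
  obtain ⟨y, -, e⟩ := h (Classical.arbitrary ι)
  refine ⟨y, fun i => ?_, e⟩
  obtain ⟨z, hz, e'⟩ := h i
  rwa [isOpenEmbedding_toExt.injective (e.symm.trans e')]

instance : LocallyCompactSpace (Punctured d) :=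
  (isOpen_compl_singleton (x := (0 : Fin d → EReal))).locallyCompactSpace

lemma measurable_toExt : Measurable (toExt (d := d)) :=
  isOpenEmbedding_toExt.continuous.measurable

lemma measurableSet_ne_zero : MeasurableSet {x : Fin d → EReal | x ≠ 0} :=
  (measurableSet_singleton (0 : Fin d → EReal)).compl

instance (u : ℝ) : IsFiniteMeasure (scaledLaw P Y u) := by
  unfold scaledLaw
  infer_instance

lemma scaledLaw_real_apply (hY : Measurable Y) (u : ℝ) {K : Set (Punctured d)}
    (hK : MeasurableSet K) :
    (scaledLaw P Y u).real K = P.real {ω | toExt (u⁻¹ • Y ω) ∈ Subtype.val '' K} := by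
  have hm : MeasurableSet (Subtype.val '' K) := 
    (MeasurableEmbedding.subtype_coe measurableSet_ne_zero).measurableSet_image' hK
  have hm' : Measurable fun ω => toExt (u⁻¹ • Y ω) := measurable_toExt.comp (hY.const_smul u⁻¹)
  unfold scaledLaw Measure.real
  rw [(MeasurableEmbedding.subtype_coe measurableSet_ne_zero).comap_apply]
  exact congrArg ENNReal.toReal (Measure.map_apply hm' hm)

/-- The tail integral against a test function converges to the limit measure. -/
lemma RegularlyVarying.tendsto_integral (h : RegularlyVarying P Y ν α) {f : Punctured d → ℝ}
    (hf : Continuous f) (hc : HasCompactSupport f) :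
    Tendsto (fun u => (tailProb P Y u)⁻¹ * ∫ x, f x ∂(scaledLaw P Y u)) atTop
      (𝓝 (∫ x, f x ∂ν)) := by
  refine (h.vague f hf hc).congr fun u => ?_
  rw [integral_smul_measure, ENNReal.toReal_inv, smul_eq_mul]
  rfl

/-- Vague convergence tests only continuous functions of compact support, so a Urysohn function is
inserted between the indicators of `K` and `L`. Using two nested sets avoids any condition on the
`ν`-measure of a boundary. -/
lemma RegularlyVarying.eventually_le (h : RegularlyVarying P Y ν α) (hY : Measurable Y)
    {K L : Set (Punctured d)} (hK : IsCompact K) (hL : IsCompact L) (hKL : K ⊆ interior L)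
    {c : ℝ} (hc : ν.real L < c) :
    ∀ᶠ u in atTop, P.real {ω | toExt (u⁻¹ • Y ω) ∈ Subtype.val '' K} ≤ c * tailProb P Y u := by
  have := h.radon
  obtain ⟨f, hf1, hf2, hf3, hf4⟩ :=
    exists_continuousMap_one_of_isCompact_subset_isOpen hK isOpen_interior hKL
  have hfL : ∀ x, f x ≤ L.indicator (fun _ => (1 : ℝ)) x := by
    intro x
    by_cases hx : x ∈ L
    · rw [Set.indicator_of_mem hx]; exact (hf4 x).2
    · rw [Set.indicator_of_notMem hx]
      have : f x = 0 := image_eq_zero_of_notMem_tsupport fun h' => hx (interior_subset (hf3 h'))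
      exact this.le
  have hKf : ∀ x, K.indicator (fun _ => (1 : ℝ)) x ≤ f x := by
    intro x
    by_cases hx : x ∈ K
    · rw [Set.indicator_of_mem hx, hf1 hx]; rfl
    · rw [Set.indicator_of_notMem hx]; exact (hf4 x).1
  have hint : ∫ x, f x ∂ν ≤ ν.real L := by
    have := integral_mono (f.continuous.integrable_of_hasCompactSupport hf2 (μ := ν))
      ((integrable_indicator_iff hL.measurableSet).2
        (integrableOn_const (hL.measure_lt_top (μ := ν)).ne)) hfL
    rwa [integral_indicator_const _ hL.measurableSet, smul_eq_mul, mul_one] at this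
  filter_upwards [(h.tendsto_integral f.continuous hf2).eventually
    (gt_mem_nhds (lt_of_le_of_lt hint hc))] with u hu
  rw [← scaledLaw_real_apply hY u hK.measurableSet]
  have h1 : (scaledLaw P Y u).real K ≤ ∫ x, f x ∂(scaledLaw P Y u) := by
    have := integral_mono (μ := scaledLaw P Y u) ((integrable_indicator_iff hK.measurableSet).2
        (integrableOn_const (measure_ne_top _ _)))
      (f.continuous.integrable_of_hasCompactSupport hf2) hKf
    rwa [integral_indicator_const _ hK.measurableSet, smul_eq_mul, mul_one] at this
  have hp := h.tailProb_pos u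
  rw [inv_mul_lt_iff₀ hp] at hu
  linarith

lemma RegularlyVarying.eventually_ge (h : RegularlyVarying P Y ν α) (hY : Measurable Y)
    {K U : Set (Punctured d)} (hK : IsCompact K) (hU : IsOpen U) (hKU : K ⊆ U)
    {c : ℝ} (hc : c < ν.real K) :
    ∀ᶠ u in atTop, c * tailProb P Y u ≤ P.real {ω | toExt (u⁻¹ • Y ω) ∈ Subtype.val '' U} := by
  have := h.radon
  obtain ⟨f, hf1, hf2, hf3, hf4⟩ :=
    exists_continuousMap_one_of_isCompact_subset_isOpen hK hU hKU
  have hfL : ∀ x, f x ≤ U.indicator (fun _ => (1 : ℝ)) x := by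
    intro x
    by_cases hx : x ∈ U
    · rw [Set.indicator_of_mem hx]; exact (hf4 x).2
    · rw [Set.indicator_of_notMem hx]
      have : f x = 0 := image_eq_zero_of_notMem_tsupport fun h' => hx (hf3 h')
      exact this.le
  have hKf : ∀ x, K.indicator (fun _ => (1 : ℝ)) x ≤ f x := by
    intro x
    by_cases hx : x ∈ K
    · rw [Set.indicator_of_mem hx, hf1 hx]; rfl
    · rw [Set.indicator_of_notMem hx]; exact (hf4 x).1
  have hint : ν.real K ≤ ∫ x, f x ∂ν := by
    have := integral_mono ((integrable_indicator_iff hK.measurableSet).2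
        (integrableOn_const (hK.measure_lt_top (μ := ν)).ne))
        (f.continuous.integrable_of_hasCompactSupport hf2 (μ := ν)) hKf
    rwa [integral_indicator_const _ hK.measurableSet, smul_eq_mul, mul_one] at this
  filter_upwards [(h.tendsto_integral f.continuous hf2).eventually
    (lt_mem_nhds (lt_of_lt_of_le hc hint))] with u hu
  rw [← scaledLaw_real_apply hY u hU.measurableSet]
  have h1 : ∫ x, f x ∂(scaledLaw P Y u) ≤ (scaledLaw P Y u).real U := by
    have := integral_mono (μ := scaledLaw P Y u)
      (f.continuous.integrable_of_hasCompactSupport hf2)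
      ((integrable_indicator_iff hU.measurableSet).2
        (integrableOn_const (measure_ne_top _ _))) hfL
    rwa [integral_indicator_const _ hU.measurableSet, smul_eq_mul, mul_one] at this
  have hp := h.tailProb_pos u
  rw [lt_inv_mul_iff₀ hp] at hu
  linarith

/-- The complement of an open cube around the origin in `[-∞, ∞]^d`. -/
def outerCube (d : ℕ) (c : ℝ) : Set (Punctured d) :=
  {x | ∃ i, (c : EReal) ≤ x.1 i ∨ x.1 i ≤ ((-c : ℝ) : EReal)}

/-- The set is closed in the compact space `[-∞, ∞]^d` and misses the origin. Because it contains
the points at infinity, a single compact set captures a whole tail. -/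
lemma isCompact_outerCube {c : ℝ} (hc : 0 < c) : IsCompact (outerCube d c) := by
  rw [Subtype.isCompact_iff]
  have : Subtype.val '' outerCube d c =
      ⋃ i : Fin d, {x | (c : EReal) ≤ x i} ∪ {x | x i ≤ ((-c : ℝ) : EReal)} := by
    ext x
    simp only [outerCube, Set.mem_image, Set.mem_ofPred_eq, Subtype.exists, exists_and_left,
      exists_prop, exists_eq_right_right, Set.mem_iUnion, Set.mem_union]
    refine ⟨fun h => h.1, fun h => ⟨h, ?_⟩⟩
    rintro rfl
    obtain ⟨i, h | h⟩ := h
    · simp only [Pi.zero_apply] at h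
      norm_cast at h; linarith
    · simp only [Pi.zero_apply] at h
      norm_cast at h; linarith
  rw [this]
  refine IsClosed.isCompact (isClosed_iUnion_of_finite fun i => ?_)
  exact (isClosed_le continuous_const (continuous_apply i)).union
    (isClosed_le (continuous_apply i) continuous_const)

lemma outerCube_subset_interior {c c' : ℝ} (h : c' < c) :
    outerCube d c ⊆ interior (outerCube d c') := by
  have ho : IsOpen {x : Punctured d | ∃ i, (c' : EReal) < x.1 i ∨ x.1 i < ((-c' : ℝ) : EReal)} := by
    simp only [Set.ofPred_exists, Set.ofPred_or]
    exact isOpen_iUnion fun i =>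
      (isOpen_lt continuous_const ((continuous_apply i).comp continuous_subtype_val)).union
        (isOpen_lt ((continuous_apply i).comp continuous_subtype_val) continuous_const)
  refine (ho.subset_interior_iff.2 ?_).trans' ?_
  · rintro x ⟨i, h | h⟩
    · exact ⟨i, Or.inl h.le⟩
    · exact ⟨i, Or.inr h.le⟩
  · rintro x ⟨i, hi | hi⟩
    · exact ⟨i, Or.inl (lt_of_lt_of_le (EReal.coe_lt_coe_iff.2 h) hi)⟩
    · exact ⟨i, Or.inr (lt_of_le_of_lt hi (EReal.coe_lt_coe_iff.2 (by linarith)))⟩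

lemma outerCube_subset_dilate {s : ℝ} (hs : 0 < s) :
    outerCube d s ⊆ dilate s (outerCube d 1) := by
  have key : ∀ y : EReal, (s : EReal) * (((s⁻¹ : ℝ) : EReal) * y) = y := fun y => by
    rw [← mul_assoc, ← EReal.coe_mul, mul_inv_cancel₀ hs.ne', EReal.coe_one, one_mul]
  have hs' : (0 : EReal) ≤ ((s⁻¹ : ℝ) : EReal) := by exact_mod_cast (inv_pos.2 hs).le
  rintro x ⟨i, hi⟩
  refine ⟨⟨fun k => ((s⁻¹ : ℝ) : EReal) * x.1 k, fun h0 => x.2 ?_⟩, ⟨i, ?_⟩, fun k => (key _).symm⟩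
  · ext k
    have := congrFun h0 k
    simp only [Pi.zero_apply] at this ⊢
    rw [← key (x.1 k), this, mul_zero]
  · refine hi.imp (fun h => ?_) fun h => ?_
    · have := mul_le_mul_of_nonneg_left h hs'
      rwa [← EReal.coe_mul, inv_mul_cancel₀ hs.ne'] at this
    · have := mul_le_mul_of_nonneg_left h hs'
      rwa [← EReal.coe_mul, mul_neg, inv_mul_cancel₀ hs.ne'] at this

lemma RegularlyVarying.measure_outerCube_le (h : RegularlyVarying P Y ν α) {s : ℝ} (hs : 0 < s) :
    ν.real (outerCube d s) ≤ s ^ (-α) * ν.real (outerCube d 1) := by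
  have := h.radon
  have h1 := isCompact_outerCube (d := d) one_pos
  have h2 : ν (outerCube d s) ≤ ENNReal.ofReal (s ^ (-α)) * ν (outerCube d 1) :=
    (measure_mono (outerCube_subset_dilate hs)).trans
      (h.homogeneous s hs _ h1.measurableSet).le
  have := ENNReal.toReal_mono
    (ENNReal.mul_ne_top ENNReal.ofReal_ne_top (h1.measure_lt_top (μ := ν)).ne) h2
  rwa [ENNReal.toReal_mul, ENNReal.toReal_ofReal (Real.rpow_nonneg hs.le _)] at this

lemma exists_abs_coord_gt {x : Vec d} {c : ℝ} (hc : 0 ≤ c) (h : c < ‖x‖) :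
    ∃ k, c / (d + 1) < |x k| := by
  by_contra! hlt
  have h1 : ‖x‖ ≤ ∑ i, |x i| := by
    have hx : x = ∑ i, EuclideanSpace.single i (x i) := by
      ext k; simp [Finset.sum_apply]
    calc ‖x‖ = ‖∑ i, EuclideanSpace.single i (x i)‖ := by rw [← hx]
      _ ≤ ∑ i, ‖EuclideanSpace.single i (x i)‖ := norm_sum_le _ _
      _ = ∑ i, |x i| := by simp
  have h2 : ∑ i, |x i| ≤ ∑ _i : Fin d, c / (d + 1) := Finset.sum_le_sum fun i _ => hlt i
  simp only [Finset.sum_const, Finset.card_univ, Fintype.card_fin, nsmul_eq_mul] at h2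
  rw [mul_div_assoc', le_div_iff₀ (by positivity)] at h2
  nlinarith [norm_nonneg x]

lemma toExt_mem_outerCube {x : Vec d} {c : ℝ} (hc : 0 < c) (h : (d + 1) * c < ‖x‖) :
    toExt x ∈ Subtype.val '' outerCube d c := by
  have hex : ∃ i, c ≤ |x i| := by
    obtain ⟨i, hi⟩ := exists_abs_coord_gt (by positivity) h
    rw [mul_div_cancel_left₀ _ (by positivity)] at hi
    exact ⟨i, hi.le⟩
  obtain ⟨i, hi⟩ := hex
  have hx0 : toExt x ≠ 0 := fun h0 => by
    rw [← toExt_zero] at h0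
    rw [isOpenEmbedding_toExt.injective h0] at hi
    simp at hi; linarith
  refine ⟨⟨toExt x, hx0⟩, ⟨i, ?_⟩, rfl⟩
  rcases le_abs.1 hi with h | h
  · exact Or.inl (EReal.coe_le_coe_iff.2 h)
  · exact Or.inr (EReal.coe_le_coe_iff.2 (by linarith))

/-- Large norm forces a point into a compact cube complement, whose `ν`-measure scales by
homogeneity. What matters later is that `C` does not depend on `s`; the exact limit of the ratio is
never needed. -/
lemma RegularlyVarying.tailProb_mul_le (h : RegularlyVarying P Y ν α) (hY : Measurable Y) :
    ∃ C > 0, ∀ s : ℝ, 0 < s →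
      ∀ᶠ u in atTop, tailProb P Y (s * u) ≤ C * s ^ (-α) * tailProb P Y u := by
  -- Since `D > d + 1`, a norm above `s` puts the point in the cube complement of size `s / D`.
  -- Halving to `s / (2 * D)` makes room for the interior, and the `+ 1` in the witness makes the
  -- bound on `ν` strict.
  set D : ℝ := d + 2 with hD
  have hD0 : 0 < D := by positivity
  have hD1 : ∀ x : ℝ, 0 < x → x / (2 * D) < x / D := fun x hx => by gcongr; linarith
  refine ⟨(2 * D) ^ α * (ν.real (outerCube d 1) + 1), by positivity, fun s hs => ?_⟩
  have hc : ν.real (outerCube d (s / (2 * D))) <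
      (2 * D) ^ α * (ν.real (outerCube d 1) + 1) * s ^ (-α) := by
    refine (h.measure_outerCube_le (by positivity)).trans_lt ?_
    have e : (s / (2 * D)) ^ (-α) = (2 * D) ^ α * s ^ (-α) := by
      rw [Real.div_rpow hs.le (by positivity), Real.rpow_neg (by positivity : (0:ℝ) ≤ 2 * D),
        div_inv_eq_mul, mul_comm]
    rw [e]
    have : 0 < (2 * D) ^ α * s ^ (-α) := by positivity
    nlinarith
  filter_upwards [h.eventually_le hY (isCompact_outerCube (div_pos hs hD0))
    (isCompact_outerCube (by positivity)) (outerCube_subset_interior (hD1 s hs)) hc,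
    eventually_gt_atTop 0] with u hu hu0
  refine le_trans (measureReal_mono fun ω hω => ?_) hu
  have hω' : s * u < ‖Y ω‖ := hω
  refine toExt_mem_outerCube (div_pos hs hD0) ?_
  rw [norm_smul, Real.norm_of_nonneg (inv_pos.2 hu0).le]
  have : (d + 1) * (s / D) < s := by
    rw [mul_div_assoc', div_lt_iff₀ hD0, hD]; nlinarith
  refine this.trans ?_
  rw [lt_inv_mul_iff₀ hu0]; linarith

end RegularVariation

/-! ### Potter bounds, moments, and probabilities of scaled sets -/

section TailBounds

variable {Ω : Type*} [MeasurableSpace Ω] {P : Measure Ω} [IsProbabilityMeasure P] {d : ℕ}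
  {Y : Ω → Vec d} {ν : Measure (Punctured d)} {α : ℝ}

/-- Potter's upper bound. -/
lemma RegularlyVarying.potter (h : RegularlyVarying P Y ν α) (hY : Measurable Y) {β : ℝ}
    (hβ : 0 ≤ β) (hβα : β < α) :
    ∃ C > 0, ∃ u₀ > 0, ∀ u, u₀ ≤ u → ∀ s : ℝ, 1 ≤ s →
      tailProb P Y (s * u) ≤ C * s ^ (-β) * tailProb P Y u := by
  obtain ⟨C, hC, hCs⟩ := h.tailProb_mul_le hY
  -- For large `M` the gap `α - β` absorbs the constant: `C * M ^ (-α) ≤ M ^ (-β)`. This one-step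
  -- bound then iterates along powers of `M` without accumulating constants.
  obtain ⟨M, hM1, hM⟩ := ((eventually_gt_atTop (1 : ℝ)).and
    ((tendsto_rpow_atTop (sub_pos.2 hβα)).eventually_ge_atTop C)).exists
  have hM0 : 0 < M := one_pos.trans hM1
  obtain ⟨u₁, hu₁⟩ := (hCs M hM0).exists_forall_of_atTop
  have hstep : ∀ u, u₁ ≤ u → tailProb P Y (M * u) ≤ M ^ (-β) * tailProb P Y u := by
    intro u hu
    refine (hu₁ u hu).trans (mul_le_mul_of_nonneg_right ?_ (tailProb_nonneg _ _ _))
    calc C * M ^ (-α) ≤ M ^ (α - β) * M ^ (-α) := by gcongr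
      _ = M ^ (-β) := by rw [← Real.rpow_add hM0]; ring_nf
  have hiter : ∀ k : ℕ, ∀ u, max u₁ 1 ≤ u →
      tailProb P Y (M ^ k * u) ≤ (M ^ (-β)) ^ k * tailProb P Y u := by
    intro k
    induction k with
    | zero => intro u _; simp
    | succ k ih =>
      intro u hu
      have hu1 : 1 ≤ u := (le_max_right _ _).trans hu
      have h1 : u₁ ≤ M ^ k * u := by
        refine ((le_max_left _ _).trans hu).trans ?_
        have := one_le_pow₀ hM1.le (n := k)
        nlinarith
      calc tailProb P Y (M ^ (k + 1) * u) = tailProb P Y (M * (M ^ k * u)) := by ring_nf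
        _ ≤ M ^ (-β) * tailProb P Y (M ^ k * u) := hstep _ h1
        _ ≤ M ^ (-β) * ((M ^ (-β)) ^ k * tailProb P Y u) := by
          gcongr; exact ih u hu
        _ = _ := by ring
  -- The factor `M ^ β` pays for rounding `s` down to a power of `M`.
  refine ⟨M ^ β, by positivity, max u₁ 1, lt_max_of_lt_right one_pos, fun u hu s hs => ?_⟩
  have hu0 : 0 ≤ u := zero_le_one.trans ((le_max_right _ _).trans hu)
  obtain ⟨k, hk1, hk2⟩ := exists_nat_pow_near hs hM1
  refine (tailProb_anti (mul_le_mul_of_nonneg_right hk1 hu0)).trans ((hiter k u hu).trans ?_)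
  refine mul_le_mul_of_nonneg_right ?_ (tailProb_nonneg _ _ _)
  have h2 : (M ^ (k + 1)) ^ (-β) ≤ s ^ (-β) :=
    Real.rpow_le_rpow_of_nonpos (by positivity) hk2.le (by linarith)
  calc (M ^ (-β)) ^ k = M ^ β * (M ^ (k + 1)) ^ (-β) := by
        rw [← Real.rpow_natCast, ← Real.rpow_natCast, ← Real.rpow_mul hM0.le,
          ← Real.rpow_mul hM0.le, ← Real.rpow_add hM0]
        push_cast; ring_nf
    _ ≤ M ^ β * s ^ (-β) := by gcongr

/-- Regularly varying tails have a polynomial lower bound. -/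
lemma RegularlyVarying.exists_rpow_le (h : RegularlyVarying P Y ν α) (hY : Measurable Y) :
    ∃ q : ℝ, 0 < q ∧ ∀ᶠ u : ℝ in atTop, u ^ (-q) ≤ tailProb P Y u := by
  obtain ⟨C₀, hC₀, hCs⟩ := h.tailProb_mul_le hY
  obtain ⟨u₁, hu₁⟩ := (hCs (1 / 2) (by norm_num)).exists_forall_of_atTop
  -- Doubling the level costs at most a factor `C`, hence a power law with exponent `log₂ C`; the
  -- maximum with 2 makes this exponent positive.
  set C := max (C₀ * (1 / 2) ^ (-α)) 2 with hC
  have hC2 : 2 ≤ C := le_max_right _ _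
  have hC0 : 0 < C := by linarith
  set u₀ := max u₁ 1 with hu₀
  have hu₀1 : 1 ≤ u₀ := le_max_right _ _
  have hiter : ∀ k : ℕ, tailProb P Y u₀ ≤ C ^ k * tailProb P Y (2 ^ k * u₀) := by
    intro k
    induction k with
    | zero => simp
    | succ k ih =>
      have h1 : u₁ ≤ 2 ^ (k + 1) * u₀ := by
        have h3 : u₁ ≤ u₀ := le_max_left _ _
        have := one_le_pow₀ (one_le_two : (1 : ℝ) ≤ 2) (n := k + 1)
        nlinarith
      have h2 := hu₁ _ h1
      rw [show (1 / 2 : ℝ) * (2 ^ (k + 1) * u₀) = 2 ^ k * u₀ by ring] at h2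
      refine ih.trans ?_
      rw [pow_succ, mul_assoc]
      gcongr
      exact h2.trans (mul_le_mul_of_nonneg_right (le_max_left _ _) (tailProb_nonneg _ _ _))
  set r := Real.logb 2 C with hr
  have hr0 : 0 < r := Real.logb_pos one_lt_two (by linarith)
  have hrC : (2 : ℝ) ^ r = C := Real.rpow_logb two_pos (by norm_num) hC0
  set c := C⁻¹ * tailProb P Y u₀ with hc
  have hc0 : 0 < c := mul_pos (inv_pos.2 hC0) (h.tailProb_pos _)
  -- The extra power of `u` absorbs the constant `c`.
  refine ⟨r + 1, by linarith, ?_⟩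
  filter_upwards [eventually_ge_atTop u₀, eventually_ge_atTop c⁻¹] with u hu huc
  have hu0 : 0 < u := by linarith
  obtain ⟨k, hk1, hk2⟩ := exists_nat_pow_near (x := u / u₀) (y := 2)
    ((one_le_div (by linarith)).2 hu) one_lt_two
  rw [div_lt_iff₀ (by linarith)] at hk2
  have h3 : tailProb P Y u₀ ≤ C ^ (k + 1) * tailProb P Y u :=
    (hiter (k + 1)).trans (mul_le_mul_of_nonneg_left (tailProb_anti hk2.le) (by positivity))
  have h4 : C ^ k ≤ u ^ r := by
    have : (2 : ℝ) ^ k ≤ u := hk1.trans (div_le_self hu0.le hu₀1)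
    calc C ^ k = ((2 : ℝ) ^ k) ^ r := by
          rw [← hrC, ← Real.rpow_natCast, ← Real.rpow_natCast, ← Real.rpow_mul two_pos.le,
            ← Real.rpow_mul two_pos.le, mul_comm]
      _ ≤ u ^ r := by gcongr
  have h5 : c ≤ u ^ r * tailProb P Y u := by
    rw [hc, inv_mul_le_iff₀ hC0]
    refine h3.trans ?_
    rw [pow_succ', mul_assoc]
    gcongr
    exact tailProb_nonneg _ _ _
  have h6 : 1 ≤ u * c := by rwa [inv_le_iff_one_le_mul₀ hc0] at huc
  have h7 : 1 ≤ u ^ (r + 1) * tailProb P Y u := by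
    rw [Real.rpow_add_one hu0.ne']
    nlinarith
  rw [Real.rpow_neg hu0.le, inv_le_iff_one_le_mul₀ (by positivity), mul_comm]
  exact h7

/-- By the layer-cake formula the moment is an integral of `t ^ (β - 1)` against the tail, which
decays like `t ^ (-γ)` for some `γ` strictly between `β` and `α`. -/
lemma RegularlyVarying.integrable_rpow (h : RegularlyVarying P Y ν α) (hY : Measurable Y) {β : ℝ}
    (hβ : 0 < β) (hβα : β < α) : Integrable (fun ω => ‖Y ω‖ ^ β) P := by
  obtain ⟨γ, hγ1, hγ2⟩ := exists_between hβα
  obtain ⟨C, hC, u₀, hu₀, hCu⟩ := h.potter hY (hβ.trans hγ1).le hγ2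
  have htail : ∀ t, u₀ < t → tailProb P Y t ≤ C * u₀ ^ γ * t ^ (-γ) := by
    intro t ht
    have h1 := hCu u₀ le_rfl (t / u₀) ((one_le_div hu₀).2 ht.le)
    rw [div_mul_cancel₀ _ hu₀.ne', Real.div_rpow (hu₀.trans ht).le hu₀.le, Real.rpow_neg hu₀.le,
      div_inv_eq_mul] at h1
    refine h1.trans ?_
    have h2 : tailProb P Y u₀ ≤ 1 := measureReal_le_one
    have h3 : 0 ≤ t ^ (-γ) := Real.rpow_nonneg (hu₀.trans ht).le _
    have h4 : 0 ≤ u₀ ^ γ := Real.rpow_nonneg hu₀.le _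
    calc C * (t ^ (-γ) * u₀ ^ γ) * tailProb P Y u₀ ≤ C * (t ^ (-γ) * u₀ ^ γ) * 1 := by gcongr
      _ = _ := by ring
  refine ⟨(hY.norm.pow_const _).aestronglyMeasurable, ?_⟩
  rw [hasFiniteIntegral_iff_ofReal (ae_of_all _ fun ω => Real.rpow_nonneg (norm_nonneg _) _),
    lintegral_rpow_eq_lintegral_meas_lt_mul _ (ae_of_all _ fun ω => norm_nonneg _)
      hY.norm.aemeasurable hβ]
  refine ENNReal.mul_lt_top ENNReal.ofReal_lt_top ?_
  have hP : ∀ t, P {ω | t < ‖Y ω‖} = ENNReal.ofReal (tailProb P Y t) := fun t => by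
    rw [tailProb, ofReal_measureReal]
  rw [← Set.Ioc_union_Ioi_eq_Ioi hu₀.le]
  refine (lintegral_union_le _ _ _).trans_lt (ENNReal.add_lt_top.2 ⟨?_, ?_⟩)
  · have hi : IntegrableOn (fun t : ℝ => t ^ (β - 1)) (Set.Ioc 0 u₀) := by
      rw [← intervalIntegrable_iff_integrableOn_Ioc_of_le hu₀.le]
      exact intervalIntegral.intervalIntegrable_rpow' (by linarith)
    refine lt_of_le_of_lt (setLIntegral_mono' measurableSet_Ioc fun t _ => ?_) hi.lintegral_lt_top
    exact mul_le_of_le_one_left' prob_le_one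
  · have hi : IntegrableOn (fun t : ℝ => C * u₀ ^ γ * t ^ (β - γ - 1)) (Set.Ioi u₀) :=
      (integrableOn_Ioi_rpow_of_lt (by linarith) hu₀).const_mul _
    refine lt_of_le_of_lt (setLIntegral_mono' measurableSet_Ioi fun t ht => ?_) hi.lintegral_lt_top
    have ht0 : 0 < t := hu₀.trans ht
    rw [hP, ← ENNReal.ofReal_mul (tailProb_nonneg _ _ _)]
    refine ENNReal.ofReal_le_ofReal ?_
    have e : t ^ (β - γ - 1) = t ^ (-γ) * t ^ (β - 1) := by
      rw [← Real.rpow_add ht0]; ring_nf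
    rw [e, ← mul_assoc]
    exact mul_le_mul_of_nonneg_right (htail t ht) (Real.rpow_nonneg ht0.le _)

lemma image_val_inPunctured_mem {S : Set (Vec d)} (h : (0 : Vec d) ∉ S) (x : Vec d) :
    toExt x ∈ Subtype.val '' inPunctured S ↔ x ∈ S := by
  rw [image_val_inPunctured h, isOpenEmbedding_toExt.injective.mem_set_image]

/-- Open sets charged by the tail measure have probabilities comparable to the norm tail. -/
lemma RegularlyVarying.exists_le_prob_of_isOpen (h : RegularlyVarying P Y ν α) (hY : Measurable Y)
    {S : Set (Vec d)} (hS : IsOpen S) (h0 : (0 : Vec d) ∉ S) (hν : 0 < ν (inPunctured S)) :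
    ∃ c > 0, ∀ᶠ u : ℝ in atTop, c * tailProb P Y u ≤ P.real {ω | u⁻¹ • Y ω ∈ S} := by
  have := h.radon
  obtain ⟨F, hFc, hFS, hFU, -⟩ := hS.exists_iUnion_isClosed
  -- Countably many compact pieces exhaust the open set, so one of them has positive measure.
  obtain ⟨n, m, hn⟩ : ∃ n m : ℕ, 0 < ν (inPunctured (F n ∩ Metric.closedBall 0 m)) := by
    by_contra! hz
    have hU : inPunctured S ⊆ ⋃ n : ℕ, ⋃ m : ℕ, inPunctured (F n ∩ Metric.closedBall 0 m) := by
      simp only [← inPunctured_iUnion]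
      refine inPunctured_mono fun x hx => ?_
      rw [← hFU] at hx
      obtain ⟨n, hn⟩ := Set.mem_iUnion.1 hx
      obtain ⟨m, hm⟩ := exists_nat_ge ‖x‖
      exact Set.mem_iUnion₂.2 ⟨n, m, hn, by simpa using hm⟩
    exact hν.ne' (measure_mono_null hU (measure_iUnion_null fun n => measure_iUnion_null fun m => nonpos_iff_eq_zero.1 (hz n m)))
  set K := inPunctured (F n ∩ Metric.closedBall 0 m) with hK
  have hKc : IsCompact K := isCompact_inPunctured
    ((isCompact_closedBall _ _).inter_left (hFc n)) fun h' => h0 (hFS n h'.1)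
  have hKr : 0 < ν.real K := ENNReal.toReal_pos hn.ne' hKc.measure_lt_top.ne
  refine ⟨ν.real K / 2, by positivity, ?_⟩
  filter_upwards [h.eventually_ge hY hKc (isOpen_inPunctured hS)
    (inPunctured_mono (Set.inter_subset_left.trans (hFS n))) (half_lt_self hKr)] with u hu
  simpa only [image_val_inPunctured_mem h0] using hu

/-- Closed sets not charged by the tail measure have neighbourhoods that are asymptotically
negligible, away from zero and infinity. -/
lemma RegularlyVarying.exists_prob_cthickening_le (h : RegularlyVarying P Y ν α)
    (hY : Measurable Y) {F : Set (Vec d)} (hF : IsClosed F) (hν : ν (inPunctured F) = 0)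
    {η M ε : ℝ} (hη : 0 < η) (hM : 0 < M) (hε : 0 < ε) :
    ∃ δ > 0, ∀ᶠ u : ℝ in atTop,
      P.real {ω | η ≤ ‖u⁻¹ • Y ω‖ ∧ ‖u⁻¹ • Y ω‖ ≤ M ∧ u⁻¹ • Y ω ∈ Metric.cthickening δ F} ≤
        ε * tailProb P Y u := by
  have := h.radon
  -- These compact sets decrease into the closed set `F`, so their `ν`-measures tend to zero. The
  -- set `K` below has a thinner shell and half the thickening, which places it in the interior of
  -- `T k`.
  let T : ℕ → Set (Vec d) := fun k =>
    (Metric.closedBall 0 (2 * M) ∩ (Metric.ball 0 (η / 2))ᶜ) ∩ Metric.cthickening (1 / (k + 1)) F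
  have hT0 : ∀ k, (0 : Vec d) ∉ T k := fun k h' => h'.1.2 (by simpa using hη)
  have hTc : ∀ k, IsCompact (inPunctured (T k)) := fun k =>
    isCompact_inPunctured ((((isCompact_closedBall _ _).inter_right
      Metric.isOpen_ball.isClosed_compl)).inter_right Metric.isClosed_cthickening) (hT0 k)
  have hanti : Antitone fun k => inPunctured (T k) := fun k l hkl =>
    inPunctured_mono (Set.inter_subset_inter_right _
      (Metric.cthickening_mono (Nat.one_div_le_one_div hkl) _))
  have hinter : ν (⋂ k, inPunctured (T k)) = 0 := by
    rw [← inPunctured_iInter]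
    refine measure_mono_null (inPunctured_mono fun x hx => ?_) hν
    rw [← hF.closure_eq, Metric.closure_eq_iInter_cthickening]
    refine Set.mem_iInter₂.2 fun δ hδ => ?_
    obtain ⟨k, hk⟩ := exists_nat_one_div_lt hδ
    exact Metric.cthickening_mono hk.le _ (Set.mem_iInter.1 hx k).2
  have hlim := tendsto_measure_iInter_atTop (μ := ν)
    (fun k => (hTc k).measurableSet.nullMeasurableSet) hanti ⟨0, (hTc 0).measure_lt_top.ne⟩
  rw [hinter] at hlim
  obtain ⟨k, hk⟩ := (hlim.eventually (gt_mem_nhds (ENNReal.ofReal_pos.2 hε))).exists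
  have hk' : ν.real (inPunctured (T k)) < ε :=
    ENNReal.toReal_lt_of_lt_ofReal hk
  have hδ : (0 : ℝ) < 1 / (k + 1) := by positivity
  let K : Set (Vec d) := (Metric.closedBall 0 M ∩ (Metric.ball 0 η)ᶜ) ∩
    Metric.cthickening (1 / (k + 1) / 2) F
  have hK0 : (0 : Vec d) ∉ K := fun h' => h'.1.2 (by simpa using hη)
  have hKc : IsCompact (inPunctured K) :=
    isCompact_inPunctured ((((isCompact_closedBall _ _).inter_right
      Metric.isOpen_ball.isClosed_compl)).inter_right Metric.isClosed_cthickening) hK0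
  have hsub : inPunctured K ⊆ interior (inPunctured (T k)) := by
    let U : Set (Vec d) := (Metric.ball 0 (2 * M) ∩ (Metric.closedBall 0 (η / 2))ᶜ) ∩
      Metric.thickening (1 / (k + 1)) F
    have hU : IsOpen U := (Metric.isOpen_ball.inter
      Metric.isClosed_closedBall.isOpen_compl).inter Metric.isOpen_thickening
    have h1 : inPunctured U ⊆ inPunctured (T k) := inPunctured_mono <|
      Set.inter_subset_inter (Set.inter_subset_inter Metric.ball_subset_closedBall
        (Set.compl_subset_compl.2 Metric.ball_subset_closedBall))
        (Metric.thickening_subset_cthickening _ _)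
    refine ((isOpen_inPunctured hU).subset_interior_iff.2 h1).trans' (inPunctured_mono ?_)
    refine Set.inter_subset_inter (Set.inter_subset_inter ?_ (Set.compl_subset_compl.2 ?_)) ?_
    · exact Metric.closedBall_subset_ball (by linarith)
    · exact Metric.closedBall_subset_ball (by linarith)
    · exact Metric.cthickening_subset_thickening' hδ (half_lt_self hδ) _
  refine ⟨1 / (k + 1) / 2, half_pos hδ, ?_⟩
  filter_upwards [h.eventually_le hY hKc (hTc k) hsub hk'] with u hu
  refine le_trans (measureReal_mono fun ω hω => ?_) hu
  refine (image_val_inPunctured_mem hK0 _).2 ⟨⟨?_, ?_⟩, hω.2.2⟩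
  · simpa using hω.2.1
  · simpa using hω.1

end TailBounds

/-! ### Exponential bounds for bounded independent summands -/

section Chernoff

variable {Ω : Type*} [MeasurableSpace Ω] {P : Measure Ω} [IsProbabilityMeasure P]

/-- For bounded variables the factor `exp |x|` is uniformly bounded, so integration controls the
moment generating function by the first two moments. -/
lemma exp_le_quadratic (x : ℝ) : Real.exp x ≤ 1 + x + x ^ 2 * Real.exp |x| := by
  have h1 : 1 + |x| ≤ Real.exp |x| := by linarith [Real.add_one_le_exp |x|]
  rcases le_or_gt |x| 1 with hx | hx
  · have h2 := (abs_le.1 (Real.abs_exp_sub_one_sub_id_le hx)).2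
    nlinarith [sq_nonneg x, abs_nonneg x]
  · rcases le_or_gt 0 x with h0 | h0
    · rw [abs_of_nonneg h0] at *
      nlinarith [mul_nonneg (show 0 ≤ x ^ 2 - 1 by nlinarith) (Real.exp_pos x).le]
    · have h3 : Real.exp x ≤ 1 := Real.exp_le_one_iff.2 h0.le
      rw [abs_of_neg h0] at *
      nlinarith [sq_nonneg x]

/-- Chernoff's bound for sums of bounded independent random variables. -/
lemma prob_sum_ge_le {ι : Type*} {F : Finset ι} {ξ : ι → Ω → ℝ} (hind : iIndepFun ξ P)
    (hmeas : ∀ i, Measurable (ξ i)) {b m v t l : ℝ} (hb : ∀ i ∈ F, ∀ ω, |ξ i ω| ≤ b)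
    (hm : ∑ i ∈ F, ∫ ω, ξ i ω ∂P ≤ m) (hv : ∑ i ∈ F, ∫ ω, ξ i ω ^ 2 ∂P ≤ v) (hl : 0 ≤ l) :
    P.real {ω | t ≤ ∑ i ∈ F, ξ i ω} ≤
      Real.exp (-(l * t) + l * m + l ^ 2 * Real.exp (l * b) * v) := by
  have hbdd : ∀ {f : Ω → ℝ} {c : ℝ}, Measurable f → (∀ ω, |f ω| ≤ c) → Integrable f P :=
    fun hf hc => Integrable.of_bound hf.aestronglyMeasurable _ (ae_of_all _ hc)
  have hmgf : ∀ i ∈ F, mgf (ξ i) P l ≤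
      Real.exp (l * ∫ ω, ξ i ω ∂P + l ^ 2 * Real.exp (l * b) * ∫ ω, ξ i ω ^ 2 ∂P) := by
    intro i hi
    have hi1 : Integrable (ξ i) P := hbdd (hmeas i) (hb i hi)
    have hi2 : Integrable (fun ω => ξ i ω ^ 2) P :=
      hbdd ((hmeas i).pow_const 2) (c := b ^ 2) fun ω => by
        rw [abs_pow]; exact pow_le_pow_left₀ (abs_nonneg _) (hb i hi ω) 2
    have hi3 : Integrable (fun ω => Real.exp (l * ξ i ω)) P :=
      hbdd (((hmeas i).const_mul l).exp) (c := Real.exp (l * b)) fun ω => by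
        rw [abs_of_pos (Real.exp_pos _)]
        exact Real.exp_le_exp.2 (mul_le_mul_of_nonneg_left ((le_abs_self _).trans (hb i hi ω)) hl)
    have hi4 : Integrable (fun ω => l ^ 2 * Real.exp (l * b) * ξ i ω ^ 2) P := hi2.const_mul _
    have hi5 : Integrable (fun ω => l * ξ i ω) P := hi1.const_mul _
    have hi6 : Integrable (fun ω => 1 + l * ξ i ω) P := (integrable_const 1).add hi5
    refine le_trans ?_ ((add_comm _ _).trans_le (Real.add_one_le_exp _))
    calc mgf (ξ i) P l ≤ ∫ ω, (1 + l * ξ i ω + l ^ 2 * Real.exp (l * b) * ξ i ω ^ 2) ∂P := by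
          refine integral_mono hi3 (hi6.add hi4) fun ω => ?_
          refine (exp_le_quadratic (l * ξ i ω)).trans ?_
          have h1 : Real.exp |l * ξ i ω| ≤ Real.exp (l * b) := by
            rw [abs_mul, abs_of_nonneg hl]
            exact Real.exp_le_exp.2 (mul_le_mul_of_nonneg_left (hb i hi ω) hl)
          have h2 : (l * ξ i ω) ^ 2 * Real.exp |l * ξ i ω| ≤
              (l * ξ i ω) ^ 2 * Real.exp (l * b) := by gcongr
          have h3 : (l * ξ i ω) ^ 2 * Real.exp (l * b) =
              l ^ 2 * Real.exp (l * b) * ξ i ω ^ 2 := by ring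
          linarith
      _ = 1 + (l * ∫ ω, ξ i ω ∂P + l ^ 2 * Real.exp (l * b) * ∫ ω, ξ i ω ^ 2 ∂P) := by
          rw [integral_add hi6 hi4,
            integral_add (integrable_const 1) hi5, integral_const_mul, integral_const_mul]
          simp [add_assoc]
  have hsum : Integrable (fun ω => Real.exp (l * (∑ i ∈ F, ξ i) ω)) P := by
    simp only [Finset.sum_apply]
    refine hbdd ((Finset.measurable_sum F fun i _ => hmeas i).const_mul l).exp
      (c := Real.exp (l * ∑ _i ∈ F, b)) fun ω => ?_
    rw [abs_of_pos (Real.exp_pos _)]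
    exact Real.exp_le_exp.2 (mul_le_mul_of_nonneg_left
      (Finset.sum_le_sum fun i hi => (le_abs_self _).trans (hb i hi ω)) hl)
  have h1 := measure_ge_le_exp_mul_mgf (μ := P) (X := ∑ i ∈ F, ξ i) t hl hsum
  simp only [Finset.sum_apply] at h1
  refine h1.trans ?_
  rw [hind.mgf_sum hmeas F]
  calc Real.exp (-l * t) * ∏ i ∈ F, mgf (ξ i) P l
      ≤ Real.exp (-l * t) * ∏ i ∈ F, Real.exp (l * ∫ ω, ξ i ω ∂P +
          l ^ 2 * Real.exp (l * b) * ∫ ω, ξ i ω ^ 2 ∂P) := by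
        gcongr with i hi
        · exact fun i _ => mgf_nonneg
        · exact hmgf i hi
    _ = Real.exp (-l * t + (l * ∑ i ∈ F, ∫ ω, ξ i ω ∂P +
          l ^ 2 * Real.exp (l * b) * ∑ i ∈ F, ∫ ω, ξ i ω ^ 2 ∂P)) := by
        rw [← Real.exp_sum, ← Real.exp_add, Finset.sum_add_distrib, Finset.mul_sum, Finset.mul_sum]
    _ ≤ _ := by
        refine Real.exp_le_exp.2 ?_
        have h2 : l * ∑ i ∈ F, ∫ ω, ξ i ω ∂P ≤ l * m := by gcongr
        have h3 : l ^ 2 * Real.exp (l * b) * ∑ i ∈ F, ∫ ω, ξ i ω ^ 2 ∂P ≤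
          l ^ 2 * Real.exp (l * b) * v := by gcongr
        linarith

end Chernoff

/-! ### Truncated weighted sums of the innovations -/

section TruncatedSums

variable {Ω : Type*} [MeasurableSpace Ω] {P : Measure Ω} [IsProbabilityMeasure P] {d : ℕ}
  {Z : ℤ → Ω → Vec d}

/-- `Z` is a sequence of centered, independent and identically distributed random vectors. -/
structure IsCenteredIID (P : Measure Ω) (Z : ℤ → Ω → Vec d) : Prop where
  meas : ∀ i, Measurable (Z i)
  indep : iIndepFun Z P
  ident : ∀ i, IdentDistrib (Z i) (Z 0) P P
  integrable_zero : Integrable (Z 0) P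
  mean_zero : ∫ ω, Z 0 ω ∂P = 0

lemma IsCenteredIID.integrable (hZ : IsCenteredIID P Z) (i : ℤ) : Integrable (Z i) P :=
  (hZ.ident i).integrable_iff.2 hZ.integrable_zero

lemma IsCenteredIID.integral_eq_zero (hZ : IsCenteredIID P Z) (i : ℤ) : ∫ ω, Z i ω ∂P = 0 :=
  (hZ.ident i).integral_eq.trans hZ.mean_zero

lemma IsCenteredIID.integral_comp (hZ : IsCenteredIID P Z) (i : ℤ) {g : Vec d → ℝ}
    (hg : Measurable g) : ∫ ω, g (Z i ω) ∂P = ∫ ω, g (Z 0 ω) ∂P :=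
  ((hZ.ident i).comp hg).integral_eq

lemma IsCenteredIID.integrable_comp (hZ : IsCenteredIID P Z) (i : ℤ) {g : Vec d → ℝ}
    (hg : Measurable g) (h : Integrable (fun ω => g (Z 0 ω)) P) :
    Integrable (fun ω => g (Z i ω)) P :=
  ((hZ.ident i).comp hg).integrable_iff.2 h

lemma IsCenteredIID.prob_mem (hZ : IsCenteredIID P Z) (i : ℤ) {S : Set (Vec d)}
    (hS : MeasurableSet S) : P.real {ω | Z i ω ∈ S} = P.real {ω | Z 0 ω ∈ S} :=
  congrArg ENNReal.toReal ((hZ.ident i).measure_mem_eq hS)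

lemma IsCenteredIID.prob_norm_gt (hZ : IsCenteredIID P Z) (i : ℤ) (u : ℝ) :
    P.real {ω | u < ‖Z i ω‖} = tailProb P (Z 0) u :=
  hZ.prob_mem i (S := {x | u < ‖x‖}) (measurableSet_lt measurable_const measurable_norm)

/-- One coordinate of the truncated weighted sum. -/
lemma IsCenteredIID.prob_truncated_coord_le (hZ : IsCenteredIID P Z) {β : ℝ} (hβ1 : 1 < β)
    (hβ2 : β ≤ 2) (hβ : Integrable (fun ω => ‖Z 0 ω‖ ^ β) P) {F : Finset ℤ}
    {B : ℤ → Vec d →L[ℝ] Vec d} {c : ℤ → ℝ} {a r : ℝ} (ha : 0 < a) (hr : 0 < r)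
    (hB : ∀ i, ‖B i‖ ≤ c i) (hca : ∀ i, c i ≤ a) {L : ℝ} (hL : ∑ i ∈ F, c i ≤ L)
    (k : Fin d) {σ : ℝ} (hσ : |σ| = 1) {t l : ℝ} (hl : 0 ≤ l) :
    P.real {ω | t ≤ σ * (∑ i ∈ F, B i (Z i ω)) k ∧ ∀ i ∈ F, c i * ‖Z i ω‖ ≤ r * a} ≤
      Real.exp (-(l * t) + l * (L * ∫ ω, {x : Vec d | r < ‖x‖}.indicator norm (Z 0 ω) ∂P) +
        l ^ 2 * Real.exp (l * (r * a)) *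
          (L * (a ^ (β - 1) * (r * a) ^ (2 - β) * ∫ ω, ‖Z 0 ω‖ ^ β ∂P))) := by
  classical
  have hc0 : ∀ i, 0 ≤ c i := fun i => (norm_nonneg _).trans (hB i)
  let φ : ℤ → Vec d → ℝ := fun i => {x | c i * ‖x‖ ≤ r * a}.indicator fun x => σ * (B i x) k
  have hS : ∀ i, MeasurableSet {x : Vec d | c i * ‖x‖ ≤ r * a} := fun i =>
    measurableSet_le (measurable_norm.const_mul _) measurable_const
  have hcoord : ∀ i, Continuous fun x : Vec d => σ * (B i x) k := fun i => by fun_prop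
  have hφm : ∀ i, Measurable (φ i) := fun i => (hcoord i).measurable.indicator (hS i)
  have habs : ∀ i x, |σ * (B i x) k| ≤ c i * ‖x‖ := fun i x => by
    rw [abs_mul, hσ, one_mul]
    exact (PiLp.norm_apply_le (B i x) k).trans ((B i).le_of_opNorm_le (hB i) x)
  have hφb : ∀ i x, |φ i x| ≤ r * a := fun i x => by
    by_cases hx : c i * ‖x‖ ≤ r * a
    · simp only [φ, Set.indicator_of_mem (show x ∈ {x | c i * ‖x‖ ≤ r * a} from hx)]
      exact (habs i x).trans hx
    · simp only [φ, Set.indicator_of_notMem (show x ∉ {x | c i * ‖x‖ ≤ r * a} from hx), abs_zero]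
      positivity
  let g : Vec d → ℝ := {x : Vec d | r < ‖x‖}.indicator norm
  have hgS : MeasurableSet {x : Vec d | r < ‖x‖} := measurableSet_lt measurable_const measurable_norm
  have hgm : Measurable g := measurable_norm.indicator hgS
  have hgi : Integrable (fun ω => g (Z 0 ω)) P := by
    refine hZ.integrable_zero.norm.mono (hgm.comp (hZ.meas 0)).aestronglyMeasurable
      (ae_of_all _ fun ω => ?_)
    exact (norm_indicator_le_norm_self (s := {x : Vec d | r < ‖x‖}) (f := norm) (Z 0 ω)).trans
      (by simp)
  -- As `c i ≤ a`, truncation acts only where `‖x‖ > r`. The untruncated term has mean zero, so the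
  -- mean of the truncated one is at most `c i` times a tail integral.
  have hle : ∀ i x, φ i x ≤ σ * (B i x) k + c i * g x := fun i x => by
    by_cases hx : c i * ‖x‖ ≤ r * a
    · simp only [φ, Set.indicator_of_mem (show x ∈ {x | c i * ‖x‖ ≤ r * a} from hx)]
      have : 0 ≤ g x := Set.indicator_nonneg (fun _ _ => norm_nonneg _) _
      have := mul_nonneg (hc0 i) this
      linarith
    · simp only [φ, Set.indicator_of_notMem (show x ∉ {x | c i * ‖x‖ ≤ r * a} from hx)]
      have hxr : r < ‖x‖ := by
        by_contra! hxr
        exact hx ((mul_le_mul (hca i) hxr (norm_nonneg _) ha.le).trans_eq (mul_comm _ _))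
      have : g x = ‖x‖ := Set.indicator_of_mem (show x ∈ {x : Vec d | r < ‖x‖} from hxr) _
      rw [this]
      linarith [neg_abs_le (σ * (B i x) k), habs i x]
  -- The square is split into powers `β` and `2 - β`: the truncation level bounds the second, and `c
  -- i ^ β ≤ c i * a ^ (β - 1)` keeps the bound linear in `c i`, hence summable against `L`.
  have hsq : ∀ i x, φ i x ^ 2 ≤ c i * (a ^ (β - 1) * (r * a) ^ (2 - β) * ‖x‖ ^ β) := fun i x => by
    by_cases hx : c i * ‖x‖ ≤ r * a
    · simp only [φ, Set.indicator_of_mem (show x ∈ {x | c i * ‖x‖ ≤ r * a} from hx)]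
      have h0 : 0 ≤ c i * ‖x‖ := mul_nonneg (hc0 i) (norm_nonneg _)
      calc (σ * (B i x) k) ^ 2 ≤ (c i * ‖x‖) ^ 2 := by
            rw [← sq_abs]; exact pow_le_pow_left₀ (abs_nonneg _) (habs i x) 2
        _ = (c i * ‖x‖) ^ β * (c i * ‖x‖) ^ (2 - β) := by
            rw [← Real.rpow_natCast, ← Real.rpow_add_of_nonneg h0 (by linarith) (by linarith)]
            norm_num
        _ ≤ (c i * ‖x‖) ^ β * (r * a) ^ (2 - β) := by
            gcongr
        _ = (c i * c i ^ (β - 1)) * ‖x‖ ^ β * (r * a) ^ (2 - β) := by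
            rw [Real.mul_rpow (hc0 i) (norm_nonneg _)]
            congr 2
            conv_lhs => rw [show β = 1 + (β - 1) by ring]
            rw [Real.rpow_add_of_nonneg (hc0 i) zero_le_one (by linarith), Real.rpow_one]
        _ ≤ (c i * a ^ (β - 1)) * ‖x‖ ^ β * (r * a) ^ (2 - β) := by
            have := Real.rpow_le_rpow (hc0 i) (hca i) (by linarith : 0 ≤ β - 1)
            have := hc0 i
            gcongr
        _ = _ := by ring
    · simp only [φ, Set.indicator_of_notMem (show x ∉ {x | c i * ‖x‖ ≤ r * a} from hx)]
      have := hc0 i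
      rw [zero_pow two_ne_zero]
      positivity
  have hbdd : ∀ {f : Ω → ℝ} {c : ℝ}, Measurable f → (∀ ω, |f ω| ≤ c) → Integrable f P :=
    fun hf hc => Integrable.of_bound hf.aestronglyMeasurable _ (ae_of_all _ hc)
  have hξ1 : ∀ i, Integrable (fun ω => φ i (Z i ω)) P := fun i =>
    hbdd ((hφm i).comp (hZ.meas i)) fun ω => hφb i _
  have hξ2 : ∀ i, Integrable (fun ω => φ i (Z i ω) ^ 2) P := fun i =>
    hbdd (((hφm i).comp (hZ.meas i)).pow_const 2) (c := (r * a) ^ 2) fun ω => by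
      rw [abs_pow]; exact pow_le_pow_left₀ (abs_nonneg _) (hφb i _) 2
  have hmean : ∀ i, ∫ ω, φ i (Z i ω) ∂P ≤ c i * ∫ ω, g (Z 0 ω) ∂P := fun i => by
    have hgi' := hZ.integrable_comp i hgm hgi
    have hzi : Integrable (fun ω => σ * (B i (Z i ω)) k) P := by
      have := ((EuclideanSpace.proj (𝕜 := ℝ) k).comp (B i)).integrable_comp (hZ.integrable i)
      exact this.const_mul σ
    have hz0 : ∫ ω, σ * (B i (Z i ω)) k ∂P = 0 := by
      have := ((EuclideanSpace.proj (𝕜 := ℝ) k).comp (B i)).integral_comp_comm (hZ.integrable i)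
      rw [hZ.integral_eq_zero, map_zero] at this
      rw [integral_const_mul]
      exact (congrArg (σ * ·) this).trans (mul_zero _)
    calc ∫ ω, φ i (Z i ω) ∂P ≤ ∫ ω, (σ * (B i (Z i ω)) k + c i * g (Z i ω)) ∂P :=
          integral_mono (hξ1 i) (hzi.add (hgi'.const_mul _)) fun ω => hle i _
      _ = c i * ∫ ω, g (Z 0 ω) ∂P := by
          rw [integral_add hzi (hgi'.const_mul _), hz0, zero_add, integral_const_mul,
            hZ.integral_comp i hgm]
  have hpm : Measurable fun x : Vec d => ‖x‖ ^ β := measurable_norm.pow_const β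
  have hvar : ∀ i, ∫ ω, φ i (Z i ω) ^ 2 ∂P ≤
      c i * (a ^ (β - 1) * (r * a) ^ (2 - β) * ∫ ω, ‖Z 0 ω‖ ^ β ∂P) := fun i => by
    have hi := hZ.integrable_comp i hpm hβ
    calc _ ≤ ∫ ω, c i * (a ^ (β - 1) * (r * a) ^ (2 - β) * ‖Z i ω‖ ^ β) ∂P :=
          integral_mono (hξ2 i) ((hi.const_mul _).const_mul _) fun ω => hsq i _
      _ = _ := by rw [integral_const_mul, integral_const_mul, hZ.integral_comp i hpm]
  have hg0 : 0 ≤ ∫ ω, g (Z 0 ω) ∂P :=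
    integral_nonneg fun ω => Set.indicator_nonneg (fun _ _ => norm_nonneg _) _
  have hE0 : 0 ≤ ∫ ω, ‖Z 0 ω‖ ^ β ∂P := integral_nonneg fun ω => by positivity
  refine le_trans (measureReal_mono fun ω hω => ?_)
    (prob_sum_ge_le (t := t) (F := F) (hZ.indep.comp φ hφm) (fun i => (hφm i).comp (hZ.meas i))
      (fun i _ ω => hφb i _) (m := L * ∫ ω, g (Z 0 ω) ∂P)
      (v := L * (a ^ (β - 1) * (r * a) ^ (2 - β) * ∫ ω, ‖Z 0 ω‖ ^ β ∂P)) ?_ ?_ hl)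
  · refine hω.1.trans_eq ?_
    have e : (∑ i ∈ F, B i (Z i ω)) k = ∑ i ∈ F, (B i (Z i ω)) k := by simp
    rw [e, Finset.mul_sum]
    refine Finset.sum_congr rfl fun i hi => ?_
    exact (Set.indicator_of_mem
      (show Z i ω ∈ {x | c i * ‖x‖ ≤ r * a} from hω.2 i hi) (fun x => σ * (B i x) k)).symm
  · calc _ ≤ ∑ i ∈ F, c i * ∫ ω, g (Z 0 ω) ∂P := Finset.sum_le_sum fun i _ => hmean i
      _ ≤ _ := by rw [← Finset.sum_mul]; gcongr
  · calc _ ≤ ∑ i ∈ F, c i * (a ^ (β - 1) * (r * a) ^ (2 - β) * ∫ ω, ‖Z 0 ω‖ ^ β ∂P) :=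
          Finset.sum_le_sum fun i _ => hvar i
      _ ≤ _ := by rw [← Finset.sum_mul]; gcongr

end TruncatedSums

/-! ### Polynomial smallness of truncated sums -/

section Core

variable {Ω : Type*} [MeasurableSpace Ω] {P : Measure Ω} [IsProbabilityMeasure P] {d : ℕ}
  {Z : ℤ → Ω → Vec d}

lemma tendsto_integral_indicator_norm {Y : Ω → Vec d} (hY : Integrable Y P) :
    Tendsto (fun r : ℝ => ∫ ω, {x : Vec d | r < ‖x‖}.indicator norm (Y ω) ∂P) atTop (𝓝 0) := by
  have hS : ∀ r : ℝ, MeasurableSet {x : Vec d | r < ‖x‖} := fun r =>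
    measurableSet_lt measurable_const measurable_norm
  have := tendsto_integral_filter_of_dominated_convergence (μ := P) (l := atTop)
    (F := fun (r : ℝ) ω => {x : Vec d | r < ‖x‖}.indicator norm (Y ω)) (f := fun _ => (0 : ℝ))
    (fun ω => ‖Y ω‖)
    (Eventually.of_forall fun r =>
      ((measurable_norm.indicator (hS r)).comp_aemeasurable
        hY.aestronglyMeasurable.aemeasurable).aestronglyMeasurable)
    (Eventually.of_forall fun r => ae_of_all _ fun ω =>
      (norm_indicator_le_norm_self (s := {x : Vec d | r < ‖x‖}) (f := norm) (Y ω)).trans (by simp))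
    hY.norm (ae_of_all _ fun ω => ?_)
  · simpa using this
  · refine tendsto_const_nhds.congr' ?_
    filter_upwards [eventually_ge_atTop ‖Y ω‖] with r hr
    exact (Set.indicator_of_notMem
      (show Y ω ∉ {x : Vec d | r < ‖x‖} from not_lt.2 hr) (norm : Vec d → ℝ)).symm

/-- Weighted sums of centered vectors, whose summands are truncated at a small multiple of `N`,
exceed `δ N` with a probability that is polynomially small of any prescribed order. -/
lemma IsCenteredIID.prob_truncated_sum_le (hZ : IsCenteredIID P Z) {β : ℝ} (hβ1 : 1 < β)
    (hβ2 : β ≤ 2) (hβ : Integrable (fun ω => ‖Z 0 ω‖ ^ β) P) {a δ q : ℝ} (ha : 0 < a)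
    (hδ : 0 < δ) (hq : 0 < q) :
    ∃ η > 0, ∀ᶠ N : ℕ in atTop, ∀ (F : Finset ℤ) (B : ℤ → Vec d →L[ℝ] Vec d) (c : ℤ → ℝ),
      (∀ i, ‖B i‖ ≤ c i) → (∀ i, c i ≤ a) → ∑ i ∈ F, c i ≤ N * a →
      P.real {ω | δ * N < ‖∑ i ∈ F, B i (Z i ω)‖ ∧ ∀ i ∈ F, c i * ‖Z i ω‖ ≤ η * N * a} ≤
        (N : ℝ) ^ (-q) := by
  set δ' := δ / (d + 1) with hδ'
  have hδ'0 : 0 < δ' := by positivity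
  -- With `l = κ log N / N` the main exponent is `-2 (q + 1) log N`, and the mean correction
  -- eventually uses at most half of it. The choice of `η` gives `exp (l η N a) = N ^ ((β - 1) /
  -- 2)`, so the variance term is of order `(log N) ^ 2 / N ^ ((β - 1) / 2)` and tends to zero.
  set κ := 2 * (q + 1) / δ' with hκ
  have hκ0 : 0 < κ := by positivity
  set η := (β - 1) / (2 * a * κ) with hη
  have hη0 : 0 < η := div_pos (by linarith) (by positivity)
  have hκηa : κ * η * a = (β - 1) / 2 := by
    rw [hη]; field_simp
  set E := ∫ ω, ‖Z 0 ω‖ ^ β ∂P with hE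
  set V := κ ^ 2 * (a * (a ^ (β - 1) * (η * a) ^ (2 - β) * E)) with hV
  have hlim1 : Tendsto (fun N : ℕ => a * ∫ ω, {x : Vec d | η * N < ‖x‖}.indicator norm (Z 0 ω) ∂P)
      atTop (𝓝 0) := by
    have := ((tendsto_integral_indicator_norm hZ.integrable_zero).comp
      (tendsto_natCast_atTop_atTop.const_mul_atTop hη0)).const_mul a
    simpa using this
  have hlim2 : Tendsto (fun N : ℕ => V * (Real.log N ^ (2 : ℝ) / (N : ℝ) ^ ((β - 1) / 2)))
      atTop (𝓝 0) := by
    have := (((isLittleO_log_rpow_rpow_atTop 2 (show 0 < (β - 1) / 2 by linarith)).tendsto_div_nhds_zero).comp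
      (tendsto_natCast_atTop_atTop (R := ℝ))).const_mul V
    simpa using this
  refine ⟨η, hη0, ?_⟩
  filter_upwards [hlim1.eventually (ge_mem_nhds (half_pos hδ'0)),
    hlim2.eventually (ge_mem_nhds one_pos), eventually_ge_atTop 1,
    (tendsto_natCast_atTop_atTop (R := ℝ)).eventually_ge_atTop (2 * d * Real.exp 1)]
    with N h1 h2 h3 h4 F B c hB hca hF
  have hN1 : (1 : ℝ) ≤ N := by exact_mod_cast h3
  have hN0 : (0 : ℝ) < N := by linarith
  have hlog : 0 ≤ Real.log N := Real.log_nonneg hN1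
  set l := κ * Real.log N / N with hl
  have hl0 : 0 ≤ l := by positivity
  set S : Fin d → ℝ → Set Ω := fun k σ => {ω | δ' * N ≤ σ * (∑ i ∈ F, B i (Z i ω)) k ∧
    ∀ i ∈ F, c i * ‖Z i ω‖ ≤ η * N * a} with hS
  have hbound : ∀ k σ, |σ| = 1 → P.real (S k σ) ≤ Real.exp 1 * (N : ℝ) ^ (-(q + 1)) := by
    intro k σ hσ
    refine (hZ.prob_truncated_coord_le hβ1 hβ2 hβ ha (mul_pos hη0 hN0) hB hca hF k hσ hl0).trans ?_
    rw [Real.rpow_def_of_pos hN0, ← Real.exp_add]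
    refine Real.exp_le_exp.2 ?_
    have e1 : l * (δ' * N) = κ * δ' * Real.log N := by
      rw [hl]; field_simp
    have e2 : l * (N * a * ∫ ω, {x : Vec d | η * N < ‖x‖}.indicator norm (Z 0 ω) ∂P) =
        κ * Real.log N * (a * ∫ ω, {x : Vec d | η * N < ‖x‖}.indicator norm (Z 0 ω) ∂P) := by
      rw [hl]; field_simp
    have e3 : Real.exp (l * (η * N * a)) = (N : ℝ) ^ ((β - 1) / 2) := by
      rw [Real.rpow_def_of_pos hN0, ← hκηa, hl]
      congr 1; field_simp
    have e4 : l ^ 2 * (N : ℝ) ^ ((β - 1) / 2) * (N * a * (a ^ (β - 1) * (η * N * a) ^ (2 - β) * E)) =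
        V * (Real.log N ^ (2 : ℝ) / (N : ℝ) ^ ((β - 1) / 2)) := by
      have e5 : (η * N * a) ^ (2 - β) = (η * a) ^ (2 - β) * (N : ℝ) ^ (2 - β) := by
        rw [← Real.mul_rpow (by positivity) hN0.le]; ring_nf
      have e6 : (N : ℝ) ^ ((β - 1) / 2) * (N : ℝ) ^ ((β - 1) / 2) * (N : ℝ) ^ (2 - β) = N := by
        rw [← Real.rpow_add hN0, ← Real.rpow_add hN0]
        ring_nf; exact Real.rpow_one _
      have hpos : (0 : ℝ) < (N : ℝ) ^ ((β - 1) / 2) := by positivity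
      rw [e5, hV, hl, Real.rpow_two]
      have e7 : (N : ℝ) ^ ((β - 1) / 2) * (N : ℝ) ^ (2 - β) / N = 1 / (N : ℝ) ^ ((β - 1) / 2) := by
        rw [div_eq_div_iff hN0.ne' hpos.ne']
        linarith
      calc _ = κ ^ 2 * Real.log N ^ 2 * a * a ^ (β - 1) * (η * a) ^ (2 - β) * E * (N / N) *
          ((N : ℝ) ^ ((β - 1) / 2) * (N : ℝ) ^ (2 - β) / N) := by ring
        _ = _ := by rw [e7, div_self hN0.ne']; ring
    rw [e1, e2, e3, e4]
    have h5 : κ * Real.log N * (a * ∫ ω, {x : Vec d | η * N < ‖x‖}.indicator norm (Z 0 ω) ∂P) ≤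
        κ * Real.log N * (δ' / 2) := by gcongr
    have h6 : κ * δ' = 2 * (q + 1) := by rw [hκ]; field_simp
    nlinarith
  have hsub : {ω | δ * N < ‖∑ i ∈ F, B i (Z i ω)‖ ∧ ∀ i ∈ F, c i * ‖Z i ω‖ ≤ η * N * a} ⊆
      ⋃ k, (S k 1 ∪ S k (-1)) := by
    rintro ω ⟨hω1, hω2⟩
    obtain ⟨k, hk⟩ := exists_abs_coord_gt (by positivity) hω1
    have hk' : δ' * N < |(∑ i ∈ F, B i (Z i ω)) k| := by
      rwa [hδ', div_mul_eq_mul_div]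
    refine Set.mem_iUnion.2 ⟨k, ?_⟩
    rcases lt_abs.1 hk' with h | h
    · exact Or.inl ⟨by linarith, hω2⟩
    · exact Or.inr ⟨by linarith, hω2⟩
  calc _ ≤ P.real (⋃ k, (S k 1 ∪ S k (-1))) := measureReal_mono hsub
    _ ≤ ∑ k, P.real (S k 1 ∪ S k (-1)) := measureReal_iUnion_fintype_le _
    _ ≤ ∑ _k : Fin d, 2 * (Real.exp 1 * (N : ℝ) ^ (-(q + 1))) := by
        refine Finset.sum_le_sum fun k _ => (measureReal_union_le _ _).trans ?_
        linarith [hbound k 1 (by simp), hbound k (-1) (by simp)]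
    _ = 2 * d * Real.exp 1 * (N : ℝ) ^ (-(q + 1)) := by
        simp; ring
    -- The spare factor `N` absorbs the `d` coordinates, the two signs and the constant `e`.
    _ ≤ N * (N : ℝ) ^ (-(q + 1)) := by gcongr
    _ = (N : ℝ) ^ (-q) := by
        rw [← Real.rpow_one_add' hN0.le (by linarith)]; ring_nf

end Core

/-! ### Countable unions and limits of partial sums -/

section ProbabilityBounds

variable {Ω : Type*} [MeasurableSpace Ω] {P : Measure Ω} [IsProbabilityMeasure P]

lemma measureReal_iUnion_le_tsum {ι : Type*} [Countable ι] {E : ι → Set Ω} {b : ι → ℝ}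
    (hb : Summable b) (h : ∀ i, P.real (E i) ≤ b i) : P.real (⋃ i, E i) ≤ ∑' i, b i := by
  have hb0 : ∀ i, 0 ≤ b i := fun i => measureReal_nonneg.trans (h i)
  refine ENNReal.toReal_le_of_le_ofReal (tsum_nonneg hb0) ?_
  rw [ENNReal.ofReal_tsum_of_nonneg hb0 hb]
  refine (measure_iUnion_le _).trans (ENNReal.tsum_le_tsum fun i => ?_)
  rw [← ofReal_measureReal]
  exact ENNReal.ofReal_le_ofReal (h i)

/-- Tail bounds pass from all finite partial sums to the sum of a series. -/
lemma prob_norm_gt_le_of_hasSum {ι E : Type*} [Countable ι] [NormedAddCommGroup E]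
    {f : ι → Ω → E} {V : Ω → E} (hV : ∀ᵐ ω ∂P, HasSum (fun i => f i ω) (V ω)) {r b : ℝ}
    {p : ι → Ω → Prop}
    (h : ∀ F : Finset ι, P.real {ω | r < ‖∑ i ∈ F, f i ω‖ ∧ ∀ i ∈ F, p i ω} ≤ b) :
    P.real {ω | r < ‖V ω‖ ∧ ∀ i, p i ω} ≤ b := by
  classical
  -- Convergence of the norms places the event almost surely in the union of these increasing sets,
  -- and continuity from below along the directed family gives the bound.
  let E : Finset ι → Set Ω := fun F =>
    {ω | (∀ F', F ⊆ F' → r < ‖∑ i ∈ F', f i ω‖) ∧ ∀ i, p i ω}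
  have hmono : Monotone E := fun F G hFG ω hω => ⟨fun F' hF' => hω.1 F' (hFG.trans hF'), hω.2⟩
  have hb : 0 ≤ b := measureReal_nonneg.trans (h ∅)
  have hE : P (⋃ F, E F) ≤ ENNReal.ofReal b := by
    rw [hmono.directed_le.measure_iUnion]
    refine iSup_le fun F => ?_
    rw [← ofReal_measureReal]
    refine ENNReal.ofReal_le_ofReal (le_trans (measureReal_mono fun ω hω => ?_) (h F))
    exact ⟨hω.1 F subset_rfl, fun i _ => hω.2 i⟩
  refine ENNReal.toReal_le_of_le_ofReal hb (le_trans (measure_mono_ae ?_) hE)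
  filter_upwards [hV] with ω hω hω'
  have h1 := (hω.norm).eventually (lt_mem_nhds hω'.1)
  obtain ⟨F, hF⟩ := eventually_atTop.1 h1
  exact Set.mem_iUnion.2 ⟨F, fun F' hF' => hF F' hF', hω'.2⟩

end ProbabilityBounds

/-! ### Coefficient mass inside and outside a window -/

section Window

/-- The coefficient bound `∑_{k ∈ [s, N + s - 1]} w (k - i)` of a window of length `N`. -/
noncomputable def windowCoef (w : ℤ → ℝ) (s : ℤ) (N : ℕ) (i : ℤ) : ℝ :=
  ∑ k ∈ Finset.Icc s (N + s - 1), w (k - i)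

variable {w : ℤ → ℝ}

lemma windowCoef_nonneg (hw : ∀ i, 0 ≤ w i) (s : ℤ) (N : ℕ) (i : ℤ) : 0 ≤ windowCoef w s N i :=
  Finset.sum_nonneg fun _ _ => hw _

lemma windowCoef_le_tsum (hw : ∀ i, 0 ≤ w i) (hs : Summable w) (s : ℤ) (N : ℕ) (i : ℤ) :
    windowCoef w s N i ≤ ∑' m, w m := by
  rw [← (Equiv.subRight i).tsum_eq w]
  exact ((Equiv.subRight i).summable_iff.2 hs).sum_le_tsum _ fun k _ => hw _

lemma card_window (s : ℤ) (N : ℕ) : (Finset.Icc s (N + s - 1)).card = N := by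
  simp

lemma hasSum_windowCoef (hs : Summable w) (s : ℤ) (N : ℕ) :
    HasSum (windowCoef w s N) (N * ∑' m, w m) := by
  have h : HasSum (windowCoef w s N) (∑ _k ∈ Finset.Icc s (N + s - 1), ∑' m, w m) :=
    hasSum_sum fun k _ => (Equiv.subLeft k).hasSum_iff.2 hs.hasSum
  rwa [Finset.sum_const, card_window, nsmul_eq_mul] at h

/-- The average over a window of length `N` of the weight that leaves the window. -/
noncomputable def leakage (w : ℤ → ℝ) (N : ℕ) : ℝ := ∑' m : ℤ, w m * (min (|m| : ℝ) N / N)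

/-- Each term is at most `w m * |m| / N`, and `w` dominates the series. -/
lemma tendsto_leakage (hw : ∀ i, 0 ≤ w i) (hs : Summable w) :
    Tendsto (leakage w) atTop (𝓝 0) := by
  have h := tendsto_tsum_of_dominated_convergence (𝓕 := atTop) (bound := w)
    (f := fun (N : ℕ) (m : ℤ) => w m * (min (|m| : ℝ) N / N)) (g := fun _ => (0 : ℝ)) hs ?_ ?_
  · rw [tsum_zero] at h; exact h
  · intro m
    have : Tendsto (fun N : ℕ => w m * ((|m| : ℝ) / N)) atTop (𝓝 0) := by
      have := (tendsto_const_div_atTop_nhds_zero_nat (|m| : ℝ)).const_mul (w m)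
      simpa using this
    refine squeeze_zero (fun N => ?_) (fun N => ?_) this
    · have := hw m; positivity
    · have := hw m
      gcongr
      exact min_le_left _ _
  · refine Eventually.of_forall fun N m => ?_
    have h0 : 0 ≤ min (|m| : ℝ) N / N := by positivity
    rw [Real.norm_of_nonneg (mul_nonneg (hw m) h0)]
    refine mul_le_of_le_one_right (hw m) (div_le_one_of_le₀ (min_le_right _ _) (by positivity))

lemma card_window_leaving_le (s m : ℤ) (N : ℕ) :
    (((Finset.Icc s (N + s - 1)).filter fun k => k - m ∉ Finset.Icc s (N + s - 1)).card : ℝ) ≤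
      min (|m| : ℝ) N := by
  refine le_min ?_ ?_
  · have h : ((Finset.Icc s (N + s - 1)).filter fun k => k - m ∉ Finset.Icc s (N + s - 1)).card ≤
        m.natAbs := by
      rcases le_total 0 m with hm | hm
      · calc _ ≤ (Finset.Ico s (s + m)).card := Finset.card_le_card fun k hk => by
              simp only [Finset.mem_filter, Finset.mem_Icc, Finset.mem_Ico] at hk ⊢
              omega
          _ ≤ _ := by rw [Int.card_Ico]; omega
      · calc _ ≤ (Finset.Ioc (N + s - 1 + m) (N + s - 1)).card := Finset.card_le_card fun k hk => by
              simp only [Finset.mem_filter, Finset.mem_Icc, Finset.mem_Ioc] at hk ⊢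
              omega
          _ ≤ _ := by rw [Int.card_Ioc]; omega
    have h' : ((m.natAbs : ℕ) : ℝ) = |(m : ℝ)| := by
      rw [Nat.cast_natAbs, Int.cast_abs]
    rw [← h']
    exact_mod_cast h
  · calc _ ≤ ((Finset.Icc s (N + s - 1)).card : ℝ) := by
          exact_mod_cast Finset.card_filter_le _ _
      _ = N := by rw [card_window]

/-- Exchanging the sums and grouping by the lag `m = k - i`, one counts the `k` in the window for
which `k - m` falls outside: at most `min |m| N`. -/
lemma tsum_windowCoef_outside_le (hw : ∀ i, 0 ≤ w i) (hs : Summable w) (s : ℤ) {N : ℕ}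
    (hN : 0 < N) :
    ∑' i, (if i ∈ Finset.Icc s (N + s - 1) then 0 else windowCoef w s N i) ≤ N * leakage w N := by
  set W := Finset.Icc s (N + s - 1) with hW
  have hk : ∀ k ∈ W, HasSum (fun i => if i ∈ W then 0 else w (k - i))
      (∑' m, if k - m ∈ W then 0 else w m) := by
    intro k _
    have h1 : Summable fun m => if k - m ∈ W then 0 else w m :=
      hs.of_nonneg_of_le (fun m => by split_ifs <;> simp [hw])
        (fun m => by split_ifs <;> simp [hw])
    have := (Equiv.subLeft k).hasSum_iff.2 h1.hasSum
    convert this using 1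
    funext i
    simp [Equiv.subLeft_apply]
  have h1 : HasSum (fun i => if i ∈ W then 0 else windowCoef w s N i)
      (∑ k ∈ W, ∑' m, if k - m ∈ W then 0 else w m) := by
    convert hasSum_sum hk using 1
    funext i
    split_ifs
    · simp
    · rfl
  rw [h1.tsum_eq]
  have h2 : HasSum (fun m => ∑ k ∈ W, if k - m ∈ W then 0 else w m)
      (∑ k ∈ W, ∑' m, if k - m ∈ W then 0 else w m) := hasSum_sum fun k _ =>
    (hs.of_nonneg_of_le (fun m => by split_ifs <;> simp [hw])
        (fun m => by split_ifs <;> simp [hw])).hasSum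
  have hN' : (0 : ℝ) < N := by exact_mod_cast hN
  have hl : Summable fun m : ℤ => w m * (min (|m| : ℝ) N / N) :=
    hs.of_nonneg_of_le (fun m => mul_nonneg (hw m) (by positivity)) fun m =>
      mul_le_of_le_one_right (hw m) (div_le_one_of_le₀ (min_le_right _ _) hN'.le)
  rw [← h2.tsum_eq, leakage, ← tsum_mul_left]
  refine h2.summable.tsum_le_tsum (fun m => ?_) (hl.mul_left _)
  have h3 : ∑ k ∈ W, (if k - m ∈ W then 0 else w m) =
      ((W.filter fun k => k - m ∉ W).card : ℝ) * w m := by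
    rw [Finset.sum_ite, Finset.sum_const_zero, zero_add, Finset.sum_const, nsmul_eq_mul]
  rw [h3]
  calc _ ≤ min (|m| : ℝ) N * w m :=
        mul_le_mul_of_nonneg_right (card_window_leaving_le s m N) (hw m)
    _ = _ := by field_simp

end Window

/-! ### Large sums of the moving average -/

section MovAvg

variable {Ω : Type*} [MeasurableSpace Ω] {P : Measure Ω} [IsProbabilityMeasure P] {d : ℕ}
  {Z : ℤ → Ω → Vec d} {A : ℤ → Matrix (Fin d) (Fin d) ℝ} {ν : Measure (Punctured d)} {α : ℝ}

/-- By Tonelli the expected sum is `E‖Z_0‖ ∑ ‖A_i‖`, which is finite. -/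
lemma IsCenteredIID.ae_summable (hZ : IsCenteredIID P Z) (hA : Summable fun i => ‖act (A i)‖) :
    ∀ᵐ ω ∂P, ∀ k : ℤ, Summable fun i => ‖act (A i)‖ * ‖Z (k - i) ω‖ := by
  refine ae_all_iff.2 fun k => ?_
  have hm : ∀ i, Measurable fun ω => ENNReal.ofReal (‖act (A i)‖ * ‖Z (k - i) ω‖) := fun i =>
    ((hZ.meas _).norm.const_mul _).ennreal_ofReal
  have hI : ∀ i, ∫⁻ ω, ENNReal.ofReal (‖act (A i)‖ * ‖Z (k - i) ω‖) ∂P =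
      ENNReal.ofReal (‖act (A i)‖ * ∫ ω, ‖Z 0 ω‖ ∂P) := fun i => by
    rw [← hZ.integral_comp (k - i) measurable_norm, ← integral_const_mul,
      ofReal_integral_eq_lintegral_ofReal ((hZ.integrable _).norm.const_mul _)
        (ae_of_all _ fun ω => by positivity)]
  have hfin : ∫⁻ ω, ∑' i, ENNReal.ofReal (‖act (A i)‖ * ‖Z (k - i) ω‖) ∂P ≠ ∞ := by
    rw [lintegral_tsum fun i => (hm i).aemeasurable]
    simp only [hI]
    exact (hA.mul_right _).tsum_ofReal_ne_top
  filter_upwards [ae_lt_top (Measurable.tsum hm) hfin] with ω hω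
  refine (ENNReal.summable_toReal hω.ne).congr fun i => ?_
  exact ENNReal.toReal_ofReal (by positivity)

/-- The coefficient of `Z_i` in `∑_{k ∈ T} X_k`. -/
noncomputable def blockCoef (A : ℤ → Matrix (Fin d) (Fin d) ℝ) (T : Finset ℤ) (i : ℤ) :
    Vec d →L[ℝ] Vec d :=
  ∑ k ∈ T, act (A (k - i))

lemma norm_blockCoef_le {T : Finset ℤ} {s : ℤ} {N : ℕ} (hT : T ⊆ Finset.Icc s (N + s - 1))
    (i : ℤ) : ‖blockCoef A T i‖ ≤ windowCoef (fun m => ‖act (A m)‖) s N i :=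
  (norm_sum_le _ _).trans (Finset.sum_le_sum_of_subset_of_nonneg hT fun _ _ _ => norm_nonneg _)

lemma hasSum_blockCoef {ω : Ω} (h : ∀ k : ℤ, Summable fun i => ‖act (A i)‖ * ‖Z (k - i) ω‖)
    (T : Finset ℤ) :
    HasSum (fun i => blockCoef A T i (Z i ω)) (∑ k ∈ T, movAvg A Z k ω) := by
  have hk : ∀ k ∈ T, HasSum (fun i => act (A (k - i)) (Z i ω)) (movAvg A Z k ω) := fun k _ => by
    have h1 : Summable fun i => act (A i) (Z (k - i) ω) :=
      (h k).of_norm_bounded fun i => (act (A i)).le_opNorm _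
    convert (Equiv.subLeft k).hasSum_iff.2 h1.hasSum using 1
    · funext i
      simp [Equiv.subLeft_apply]
    · rfl
  convert hasSum_sum hk using 1
  funext i
  simp [blockCoef]

/-- A positive bound for the sums of the norms of the coefficients. -/
noncomputable def totalWeight (A : ℤ → Matrix (Fin d) (Fin d) ℝ) : ℝ := 1 + ∑' i, ‖act (A i)‖

lemma totalWeight_pos : 0 < totalWeight A := by
  have : 0 ≤ ∑' i, ‖act (A i)‖ := tsum_nonneg fun _ => norm_nonneg _
  unfold totalWeight; linarith

lemma windowCoef_le_totalWeight (hA : Summable fun i => ‖act (A i)‖) (s : ℤ) (N : ℕ) (i : ℤ) :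
    windowCoef (fun m => ‖act (A m)‖) s N i ≤ totalWeight A :=
  (windowCoef_le_tsum (fun _ => norm_nonneg _) hA s N i).trans (by unfold totalWeight; linarith)

lemma sum_windowCoef_le (hA : Summable fun i => ‖act (A i)‖) (s : ℤ) (N : ℕ) (F : Finset ℤ) :
    ∑ i ∈ F, windowCoef (fun m => ‖act (A m)‖) s N i ≤ N * totalWeight A := by
  have h := hasSum_windowCoef hA s N
  refine (h.summable.sum_le_tsum _ fun i _ => windowCoef_nonneg (fun _ => norm_nonneg _) _ _ _).trans ?_
  rw [h.tsum_eq]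
  unfold totalWeight
  gcongr
  linarith

/-- Sums of the moving average over a window of length `N` are polynomially unlikely to exceed
`δ N` if every innovation contributes at most a small multiple of `N`. -/
lemma IsCenteredIID.prob_window_sum_le (hZ : IsCenteredIID P Z) {β : ℝ} (hβ1 : 1 < β)
    (hβ2 : β ≤ 2) (hβ : Integrable (fun ω => ‖Z 0 ω‖ ^ β) P)
    (hA : Summable fun i => ‖act (A i)‖) {δ q : ℝ} (hδ : 0 < δ) (hq : 0 < q) :
    ∃ η > 0, ∀ᶠ N : ℕ in atTop, ∀ (s : ℤ) (T : Finset ℤ), T ⊆ Finset.Icc s (N + s - 1) →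
      P.real {ω | δ * N < ‖∑ k ∈ T, movAvg A Z k ω‖ ∧
        ∀ i, windowCoef (fun m => ‖act (A m)‖) s N i * ‖Z i ω‖ ≤ η * N * totalWeight A} ≤
        (N : ℝ) ^ (-q) := by
  obtain ⟨η, hη, h⟩ := hZ.prob_truncated_sum_le hβ1 hβ2 hβ (totalWeight_pos (A := A)) hδ hq
  refine ⟨η, hη, ?_⟩
  filter_upwards [h] with N hN s T hT
  refine prob_norm_gt_le_of_hasSum (f := fun i ω => blockCoef A T i (Z i ω)) ?_ fun F =>
    hN F (blockCoef A T) (windowCoef (fun m => ‖act (A m)‖) s N) (norm_blockCoef_le hT)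
      (windowCoef_le_totalWeight hA s N) (sum_windowCoef_le hA s N F)
  filter_upwards [hZ.ae_summable hA] with ω hω
  exact hasSum_blockCoef hω T

/-- Innovations outside a window rarely contribute to the sum over the window. -/
lemma IsCenteredIID.prob_outside_le (hZ : IsCenteredIID P Z)
    (hrv : RegularlyVarying P (Z 0) ν α) (hα : 1 < α) (hA : Summable fun i => ‖act (A i)‖) :
    ∃ C > 0, ∀ η > 0, ∀ᶠ N : ℕ in atTop, ∀ s : ℤ,
      P.real {ω | ∃ i ∉ Finset.Icc s (N + s - 1),
        η * N * totalWeight A < windowCoef (fun m => ‖act (A m)‖) s N i * ‖Z i ω‖} ≤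
        C * leakage (fun m => ‖act (A m)‖) N * (N * tailProb P (Z 0) (η * N)) := by
  -- Exponent 1 is allowed because `α > 1`, and it makes each probability linear in `c i`, so that
  -- the sum over outside indices is governed by `leakage`.
  obtain ⟨C, hC, u₀, hu₀, hp⟩ := hrv.potter (hZ.meas 0) zero_le_one hα
  have ha := totalWeight_pos (A := A)
  refine ⟨C / totalWeight A, by positivity, fun η hη => ?_⟩
  filter_upwards [(tendsto_natCast_atTop_atTop.const_mul_atTop hη).eventually_ge_atTop u₀,
    eventually_gt_atTop 0] with N hN hN0 s
  set c := windowCoef (fun m => ‖act (A m)‖) s N with hc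
  set W := Finset.Icc s (N + s - 1) with hW
  set a := totalWeight A with ha'
  have hc0 : ∀ i, 0 ≤ c i := windowCoef_nonneg (fun _ => norm_nonneg _) s N
  have hcs : Summable fun i => if i ∈ W then 0 else c i :=
    (hasSum_windowCoef hA s N).summable.of_nonneg_of_le
      (fun i => by split_ifs; exacts [le_rfl, hc0 i]) (fun i => by split_ifs; exacts [hc0 i, le_rfl])
  have hN' : (0 : ℝ) < N := by exact_mod_cast hN0
  have hE : ∀ i, P.real {ω | i ∉ W ∧ η * N * a < c i * ‖Z i ω‖} ≤
      C / a * tailProb P (Z 0) (η * N) * (if i ∈ W then 0 else c i) := by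
    intro i
    by_cases hi : i ∈ W
    · simp [hi]
    rw [if_neg hi]
    rcases (hc0 i).eq_or_lt with h0 | h0
    · have : {ω | i ∉ W ∧ η * N * a < c i * ‖Z i ω‖} = ∅ := by
        ext ω
        simp only [← h0, zero_mul, Set.mem_ofPred_eq, Set.mem_empty_iff_false, iff_false, not_and,
          not_lt]
        intro _; positivity
      rw [this, ← h0]; simp
    · have h1 : P.real {ω | i ∉ W ∧ η * N * a < c i * ‖Z i ω‖} ≤
          tailProb P (Z 0) (a / c i * (η * N)) := by
        rw [← hZ.prob_norm_gt i]
        refine measureReal_mono fun ω hω => ?_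
        have := hω.2
        simp only [Set.mem_ofPred_eq]
        rw [div_mul_eq_mul_div, div_lt_iff₀ h0]
        linarith
      refine h1.trans ((hp _ hN _ ((one_le_div h0).2
        (windowCoef_le_totalWeight hA s N i))).trans_eq ?_)
      rw [Real.rpow_neg_one, inv_div]
      ring
  have hU : {ω | ∃ i ∉ W, η * N * a < c i * ‖Z i ω‖} =
      ⋃ i, {ω | i ∉ W ∧ η * N * a < c i * ‖Z i ω‖} := by
    ext ω; simp
  rw [hU]
  refine (measureReal_iUnion_le_tsum (hcs.mul_left _) hE).trans ?_
  rw [tsum_mul_left]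
  have h2 := tsum_windowCoef_outside_le (w := fun m => ‖act (A m)‖) (fun _ => norm_nonneg _) hA s hN0
  have h3 : 0 ≤ C / a * tailProb P (Z 0) (η * N) :=
    mul_nonneg (by positivity) (tailProb_nonneg _ _ _)
  calc _ ≤ C / a * tailProb P (Z 0) (η * N) * (N * leakage (fun m => ‖act (A m)‖) N) :=
        mul_le_mul_of_nonneg_left h2 h3
    _ = _ := by ring

/-- Markov's inequality restricted to the tail event bounds this by a truncated first moment, which
vanishes by integrability. -/
lemma tendsto_mul_tailProb {Y : Ω → Vec d} (hY : Measurable Y) (hi : Integrable Y P) {η : ℝ}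
    (hη : 0 < η) : Tendsto (fun N : ℕ => N * tailProb P Y (η * N)) atTop (𝓝 0) := by
  have h1 : Tendsto (fun N : ℕ => η⁻¹ *
      ∫ ω, {x : Vec d | η * N < ‖x‖}.indicator norm (Y ω) ∂P) atTop (𝓝 0) := by
    have := ((tendsto_integral_indicator_norm hi).comp
      (tendsto_natCast_atTop_atTop.const_mul_atTop hη)).const_mul η⁻¹
    simpa using this
  refine squeeze_zero (fun N => mul_nonneg (Nat.cast_nonneg _) (tailProb_nonneg _ _ _))
    (fun N => ?_) h1
  have hS : MeasurableSet {ω | η * N < ‖Y ω‖} := measurableSet_lt measurable_const hY.norm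
  have e : (fun ω => {x : Vec d | η * N < ‖x‖}.indicator norm (Y ω)) =
      {ω | η * N < ‖Y ω‖}.indicator fun ω => ‖Y ω‖ := rfl
  have h2 : η * N * tailProb P Y (η * N) ≤
      ∫ ω, {x : Vec d | η * N < ‖x‖}.indicator norm (Y ω) ∂P := by
    rw [e, integral_indicator hS]
    have := setIntegral_mono_on (μ := P) (s := {ω | η * N < ‖Y ω‖}) (f := fun _ => η * N)
      (g := fun ω => ‖Y ω‖) (integrableOn_const (measure_ne_top _ _)) hi.norm.integrableOn hS
      fun ω hω => le_of_lt hω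
    rw [setIntegral_const, smul_eq_mul, mul_comm] at this
    exact this
  rw [le_inv_mul_iff₀ hη]
  linarith

/-- The maximal weak law of large numbers for the sums over windows of length `n`. -/
lemma IsCenteredIID.tendsto_prob_max_blockSum (hZ : IsCenteredIID P Z)
    (hrv : RegularlyVarying P (Z 0) ν α) (hα : 1 < α) (hA : Summable fun i => ‖act (A i)‖)
    {δ : ℝ} (hδ : 0 < δ) :
    Tendsto (fun n : ℕ => P.real {ω | ∃ j ∈ Finset.Icc (0 : ℤ) n, δ * n < ‖blockSum A Z j n ω‖})
      atTop (𝓝 0) := by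
  obtain ⟨β, hβ1, hβ2⟩ := exists_between (lt_min hα one_lt_two)
  have hβ := hrv.integrable_rpow (hZ.meas 0) (by linarith) (hβ2.trans_le (min_le_left _ _))
  -- All blocks with `0 ≤ j ≤ n` lie in the window `[0, 2n]` of length `N = 2n + 1 ≤ 3n`, whence `δ
  -- / 3`. The order `N ^ (-2)` survives the union over `n + 1` blocks.
  obtain ⟨η, hη, hcore⟩ := hZ.prob_window_sum_le hβ1 (hβ2.le.trans (min_le_right _ _)) hβ hA
    (show 0 < δ / 3 by positivity) two_pos
  obtain ⟨C, hC, hout⟩ := hZ.prob_outside_le hrv hα hA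
  have hodd : Tendsto (fun n : ℕ => 2 * n + 1) atTop atTop :=
    tendsto_atTop_mono (fun n => by simp only [id]; omega) tendsto_id
  have hlim : Tendsto (fun N : ℕ => (N : ℝ)⁻¹ +
      (C * leakage (fun m => ‖act (A m)‖) N * (N * tailProb P (Z 0) (η * N)) +
        N * tailProb P (Z 0) (η * N))) atTop (𝓝 0) := by
    have h1 := tendsto_mul_tailProb (hZ.meas 0) hZ.integrable_zero hη
    have h2 := ((tendsto_leakage (w := fun m => ‖act (A m)‖) (fun _ => norm_nonneg _) hA).const_mul C).mul h1
    have h3 := (tendsto_inv_atTop_nhds_zero_nat (𝕜 := ℝ)).add (h2.add h1)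
    simpa using h3
  refine squeeze_zero' (Eventually.of_forall fun _ => measureReal_nonneg) ?_ (hlim.comp hodd)
  filter_upwards [hodd.eventually hcore, hodd.eventually (hout η hη), eventually_ge_atTop 1]
    with n h1 h2 hn
  set N := 2 * n + 1 with hN
  simp only [Function.comp_apply, ← hN]
  have ha := totalWeight_pos (A := A)
  set c := windowCoef (fun m => ‖act (A m)‖) 0 N with hc
  set W := Finset.Icc (0 : ℤ) (N + 0 - 1) with hW
  have hN1 : (1 : ℝ) ≤ n := by exact_mod_cast hn
  have hNn : (N : ℝ) = 2 * n + 1 := by rw [hN]; push_cast; ring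
  let E₁ : ℤ → Set Ω := fun j => {ω | δ / 3 * N < ‖∑ k ∈ Finset.Icc j (n + j - 1), movAvg A Z k ω‖ ∧
    ∀ i, c i * ‖Z i ω‖ ≤ η * N * totalWeight A}
  let E₂ : Set Ω := {ω | ∃ i ∉ W, η * N * totalWeight A < c i * ‖Z i ω‖}
  let E₃ : ℤ → Set Ω := fun i => {ω | η * N < ‖Z i ω‖}
  have hsub : {ω | ∃ j ∈ Finset.Icc (0 : ℤ) n, δ * n < ‖blockSum A Z j n ω‖} ⊆
      (⋃ j ∈ Finset.Icc (0 : ℤ) n, E₁ j) ∪ (E₂ ∪ ⋃ i ∈ W, E₃ i) := by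
    rintro ω ⟨j, hj, hω⟩
    by_cases hsmall : ∀ i, c i * ‖Z i ω‖ ≤ η * N * totalWeight A
    · left
      refine Set.mem_iUnion₂.2 ⟨j, hj, lt_of_le_of_lt ?_ hω, hsmall⟩
      rw [hNn]; nlinarith
    · right
      push Not at hsmall
      obtain ⟨i, hi⟩ := hsmall
      by_cases hiW : i ∈ W
      · right
        refine Set.mem_iUnion₂.2 ⟨i, hiW, ?_⟩
        have h5 : c i * ‖Z i ω‖ ≤ totalWeight A * ‖Z i ω‖ :=
          mul_le_mul_of_nonneg_right (windowCoef_le_totalWeight hA 0 N i) (norm_nonneg _)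
        have h6 : totalWeight A * (η * N) < totalWeight A * ‖Z i ω‖ := by linarith
        exact lt_of_mul_lt_mul_left h6 ha.le
      · exact Or.inl ⟨i, hiW, hi⟩
  have hb1 : P.real (⋃ j ∈ Finset.Icc (0 : ℤ) n, E₁ j) ≤ (N : ℝ)⁻¹ := by
    refine (measureReal_biUnion_finset_le _ _).trans ?_
    calc _ ≤ ∑ _j ∈ Finset.Icc (0 : ℤ) n, (N : ℝ) ^ (-2 : ℝ) := by
          refine Finset.sum_le_sum fun j hj => h1 0 _ fun k hk => ?_
          simp only [Finset.mem_Icc] at hj hk ⊢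
          omega
      _ = (n + 1) * (N : ℝ) ^ (-2 : ℝ) := by
          rw [Finset.sum_const, nsmul_eq_mul]
          congr 1
          simp
      _ ≤ N * (N : ℝ) ^ (-2 : ℝ) := by
          gcongr; linarith
      _ = (N : ℝ)⁻¹ := by
          rw [← Real.rpow_one_add' (by positivity) (by norm_num), ← Real.rpow_neg_one]
          norm_num
  have hb3 : P.real (⋃ i ∈ W, E₃ i) ≤ N * tailProb P (Z 0) (η * N) := by
    refine (measureReal_biUnion_finset_le _ _).trans ?_
    rw [Finset.sum_congr rfl fun i _ => hZ.prob_norm_gt i _, Finset.sum_const, nsmul_eq_mul,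
      card_window]
  calc _ ≤ _ := measureReal_mono hsub
    _ ≤ P.real (⋃ j ∈ Finset.Icc (0 : ℤ) n, E₁ j) + P.real (E₂ ∪ ⋃ i ∈ W, E₃ i) :=
        measureReal_union_le _ _
    _ ≤ P.real (⋃ j ∈ Finset.Icc (0 : ℤ) n, E₁ j) + (P.real E₂ + P.real (⋃ i ∈ W, E₃ i)) := by
        gcongr; exact measureReal_union_le _ _
    _ ≤ _ := by
        gcongr; exact h2 0

/-- A large sum over a window is caused by a large innovation in the window. -/
lemma IsCenteredIID.prob_no_jump_le (hZ : IsCenteredIID P Z)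
    (hrv : RegularlyVarying P (Z 0) ν α) (hα : 1 < α) (hA : Summable fun i => ‖act (A i)‖)
    {δ : ℝ} (hδ : 0 < δ) :
    ∃ η₀ > 0, ∀ η ≤ η₀, ∀ ε > 0, ∀ᶠ N : ℕ in atTop, ∀ s : ℤ,
      P.real {ω | δ * N < ‖blockSum A Z s N ω‖ ∧
        ∀ i ∈ Finset.Icc s (N + s - 1), ‖Z i ω‖ ≤ η * N} ≤ ε * (N * tailProb P (Z 0) N) := by
  obtain ⟨β, hβ1, hβ2⟩ := exists_between (lt_min hα one_lt_two)
  have hβ := hrv.integrable_rpow (hZ.meas 0) (by linarith) (hβ2.trans_le (min_le_left _ _))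
  -- Taking this `q` in the truncated bound gives at most `P(‖Z_0‖ > N)`, a factor `N` below the
  -- target scale.
  obtain ⟨q, hq, hlow⟩ := hrv.exists_rpow_le (hZ.meas 0)
  obtain ⟨η₀, hη₀, hcore⟩ := hZ.prob_window_sum_le hβ1 (hβ2.le.trans (min_le_right _ _)) hβ hA
    hδ hq
  obtain ⟨C, hC, hout⟩ := hZ.prob_outside_le hrv hα hA
  obtain ⟨C', hC', hreg⟩ := hrv.tailProb_mul_le (hZ.meas 0)
  refine ⟨η₀, hη₀, fun η hη ε hε => ?_⟩
  have hlim : Tendsto (fun N : ℕ => (N : ℝ)⁻¹ +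
      C * leakage (fun m => ‖act (A m)‖) N * (C' * η₀ ^ (-α))) atTop (𝓝 0) := by
    have h2 := ((tendsto_leakage (w := fun m => ‖act (A m)‖) (fun _ => norm_nonneg _) hA).const_mul
      C).mul_const (C' * η₀ ^ (-α))
    have h3 := (tendsto_inv_atTop_nhds_zero_nat (𝕜 := ℝ)).add h2
    simpa using h3
  have hcast := tendsto_natCast_atTop_atTop (R := ℝ)
  filter_upwards [hcore, hout η₀ hη₀, hcast.eventually hlow, hcast.eventually (hreg η₀ hη₀),
    hlim.eventually (ge_mem_nhds hε), eventually_ge_atTop 1] with N h1 h2 h3 h4 h5 hN s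
  have ha := totalWeight_pos (A := A)
  have hN1 : (1 : ℝ) ≤ N := by exact_mod_cast hN
  have hl0 : 0 ≤ leakage (fun m => ‖act (A m)‖) N := tsum_nonneg fun m => by positivity
  set c := windowCoef (fun m => ‖act (A m)‖) s N with hc
  let E₁ : Set Ω := {ω | δ * N < ‖∑ k ∈ Finset.Icc s (N + s - 1), movAvg A Z k ω‖ ∧
    ∀ i, c i * ‖Z i ω‖ ≤ η₀ * N * totalWeight A}
  let E₂ : Set Ω := {ω | ∃ i ∉ Finset.Icc s (N + s - 1),
    η₀ * N * totalWeight A < c i * ‖Z i ω‖}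
  have hsub : {ω | δ * N < ‖blockSum A Z s N ω‖ ∧
      ∀ i ∈ Finset.Icc s (N + s - 1), ‖Z i ω‖ ≤ η * N} ⊆ E₁ ∪ E₂ := by
    rintro ω ⟨hω, hW⟩
    by_cases hsmall : ∀ i, c i * ‖Z i ω‖ ≤ η₀ * N * totalWeight A
    · exact Or.inl ⟨hω, hsmall⟩
    · right
      push Not at hsmall
      obtain ⟨i, hi⟩ := hsmall
      refine ⟨i, fun hiW => hi.not_ge ?_, hi⟩
      calc c i * ‖Z i ω‖ ≤ totalWeight A * (η₀ * N) :=
            mul_le_mul (windowCoef_le_totalWeight hA s N i)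
              ((hW i hiW).trans (by gcongr)) (norm_nonneg _) ha.le
        _ = _ := by ring
  have hp0 := tailProb_nonneg P (Z 0) N
  calc _ ≤ P.real (E₁ ∪ E₂) := measureReal_mono hsub
    _ ≤ P.real E₁ + P.real E₂ := measureReal_union_le _ _
    _ ≤ tailProb P (Z 0) N + C * leakage (fun m => ‖act (A m)‖) N *
          (N * (C' * η₀ ^ (-α) * tailProb P (Z 0) N)) :=
        add_le_add ((h1 s _ subset_rfl).trans h3) ((h2 s).trans (by gcongr))
    _ = ((N : ℝ)⁻¹ + C * leakage (fun m => ‖act (A m)‖) N * (C' * η₀ ^ (-α))) *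
          (N * tailProb P (Z 0) N) := by
        field_simp
    _ ≤ _ := by gcongr

end MovAvg

/-! ### Two jumps, and a jump together with the remaining sum -/

section Independence

variable {Ω : Type*} [MeasurableSpace Ω] {P : Measure Ω} [IsProbabilityMeasure P] {d : ℕ}
  {Z : ℤ → Ω → Vec d} {A : ℤ → Matrix (Fin d) (Fin d) ℝ}

lemma IsCenteredIID.prob_two_jumps_le (hZ : IsCenteredIID P Z) (W : Finset ℤ) (u : ℝ) :
    P.real {ω | ∃ i ∈ W, ∃ l ∈ W, i ≠ l ∧ u < ‖Z i ω‖ ∧ u < ‖Z l ω‖} ≤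
      (W.card * tailProb P (Z 0) u) * (W.card * tailProb P (Z 0) u) := by
  have hS : MeasurableSet {x : Vec d | u < ‖x‖} := measurableSet_lt measurable_const measurable_norm
  have hpair : ∀ i l, P.real {ω | i ≠ l ∧ u < ‖Z i ω‖ ∧ u < ‖Z l ω‖} ≤
      tailProb P (Z 0) u * tailProb P (Z 0) u := by
    intro i l
    by_cases hil : i = l
    · simp only [hil, ne_eq, not_true_eq_false, false_and]
      rw [show {ω : Ω | False} = ∅ from rfl, measureReal_empty]
      exact mul_nonneg (tailProb_nonneg _ _ _) (tailProb_nonneg _ _ _)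
    · have h := (hZ.indep.indepFun hil).measure_inter_preimage_eq_mul _ _ hS hS
      have h' := congrArg ENNReal.toReal h
      rw [ENNReal.toReal_mul] at h'
      rw [← hZ.prob_norm_gt i]
      nth_rewrite 2 [hZ.prob_norm_gt i]
      rw [← hZ.prob_norm_gt l]
      refine le_trans (measureReal_mono fun ω hω => ?_) h'.le
      exact hω.2
  have hsub : {ω | ∃ i ∈ W, ∃ l ∈ W, i ≠ l ∧ u < ‖Z i ω‖ ∧ u < ‖Z l ω‖} ⊆
      ⋃ i ∈ W, ⋃ l ∈ W, {ω | i ≠ l ∧ u < ‖Z i ω‖ ∧ u < ‖Z l ω‖} := by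
    rintro ω ⟨i, hi, l, hl, h⟩
    exact Set.mem_iUnion₂.2 ⟨i, hi, Set.mem_iUnion₂.2 ⟨l, hl, h⟩⟩
  refine (measureReal_mono hsub (measure_ne_top _ _)).trans ?_
  calc _ ≤ ∑ i ∈ W, P.real (⋃ l ∈ W, {ω | i ≠ l ∧ u < ‖Z i ω‖ ∧ u < ‖Z l ω‖}) :=
        measureReal_biUnion_finset_le _ _
    _ ≤ ∑ _i ∈ W, ∑ _l ∈ W, tailProb P (Z 0) u * tailProb P (Z 0) u :=
        Finset.sum_le_sum fun i _ => (measureReal_biUnion_finset_le _ _).trans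
          (Finset.sum_le_sum fun l _ => hpair i l)
    _ = _ := by simp only [Finset.sum_const, nsmul_eq_mul]; ring

/-- The σ-algebra is arbitrary so that it can be the one generated by the innovations other than `Z
i`; `Finset ℤ` is countable. -/
lemma measurableSet_eventually_sum_erase {Ω : Type*} {m : MeasurableSpace Ω} {Z : ℤ → Ω → Vec d}
    {i : ℤ} (hZ : ∀ l, l ≠ i → Measurable (Z l)) {J : Finset ℤ} {B : ℤ → ℤ → Vec d →L[ℝ] Vec d}
    {t : ℝ} : MeasurableSet (⋃ j ∈ J, ⋃ F : Finset ℤ, ⋂ F' : Finset ℤ, ⋂ _ : F ⊆ F',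
      {ω | t < ‖∑ l ∈ F'.erase i, B j l (Z l ω)‖}) := by
  refine Finset.measurableSet_biUnion _ fun j _ => MeasurableSet.iUnion fun F =>
    MeasurableSet.iInter fun F' => MeasurableSet.iInter fun _ => ?_
  refine measurableSet_lt measurable_const (measurable_norm.comp ?_)
  exact Finset.measurable_sum _ fun l hl =>
    (B j l).continuous.measurable.comp (hZ l (Finset.ne_of_mem_erase hl))

/-- Given a jump of one innovation, the other innovations still contribute little to the sums. -/
lemma IsCenteredIID.prob_jump_and_rest_le (hZ : IsCenteredIID P Z)
    (hA : Summable fun i => ‖act (A i)‖) (i : ℤ) (n : ℕ) {u t : ℝ} (ht : 0 < t) :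
    P.real {ω | u < ‖Z i ω‖ ∧ ∃ j ∈ Finset.Icc (0 : ℤ) n,
        t < ‖blockSum A Z j n ω - blockCoef A (Finset.Icc j (n + j - 1)) i (Z i ω)‖} ≤
      tailProb P (Z 0) u *
        (P.real {ω | ∃ j ∈ Finset.Icc (0 : ℤ) n, t / 3 < ‖blockSum A Z j n ω‖} +
          tailProb P (Z 0) (t / (3 * totalWeight A))) := by
  classical
  have ha := totalWeight_pos (A := A)
  let B : ℤ → ℤ → Vec d →L[ℝ] Vec d := fun j => blockCoef A (Finset.Icc j (n + j - 1))
  let R : ℤ → Finset ℤ → Ω → Vec d := fun j F ω => ∑ l ∈ F.erase i, B j l (Z l ω)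
  -- Eventual largeness of partial sums without `Z i` replaces largeness of their almost sure limit.
  -- Thus `D` is exactly, not just up to null sets, an event of the other innovations and is
  -- independent of the jump.
  let D : Set Ω := ⋃ j ∈ Finset.Icc (0 : ℤ) n, ⋃ F : Finset ℤ, ⋂ F' : Finset ℤ, ⋂ _ : F ⊆ F',
    {ω | t < ‖R j F' ω‖}
  have hDm : MeasurableSet[⨆ l ∈ ({i}ᶜ : Set ℤ), MeasurableSpace.comap (Z l) inferInstance] D := by
    refine measurableSet_eventually_sum_erase fun l hl => Measurable.of_comap_le ?_
    exact le_iSup₂_of_le (f := fun l (_ : l ∈ ({i}ᶜ : Set ℤ)) =>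
      MeasurableSpace.comap (Z l) inferInstance) l hl le_rfl
  have hJm : MeasurableSet[⨆ l ∈ ({i} : Set ℤ), MeasurableSpace.comap (Z l) inferInstance]
      {ω | u < ‖Z i ω‖} := by
    have h1 : MeasurableSet[MeasurableSpace.comap (Z i) inferInstance] {ω | u < ‖Z i ω‖} :=
      ⟨{x | u < ‖x‖}, measurableSet_lt measurable_const measurable_norm, rfl⟩
    have h2 : MeasurableSpace.comap (Z i) inferInstance ≤
        ⨆ l ∈ ({i} : Set ℤ), MeasurableSpace.comap (Z l) inferInstance :=
      le_iSup₂_of_le (f := fun l (_ : l ∈ ({i} : Set ℤ)) =>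
        MeasurableSpace.comap (Z l) inferInstance) i rfl le_rfl
    exact h2 _ h1
  have hind := (Indep_iff _ _ _).1 (indep_iSup_of_disjoint (fun l => (hZ.meas l).comap_le)
    hZ.indep.iIndep (disjoint_compl_right (a := ({i} : Set ℤ)))) _ _ hJm hDm
  have hrest : ∀ ω, (∀ k : ℤ, Summable fun l => ‖act (A l)‖ * ‖Z (k - l) ω‖) → ∀ j,
      Tendsto (fun F => R j F ω) atTop (𝓝 (blockSum A Z j n ω - B j i (Z i ω))) := by
    intro ω hω j
    have h1 := hasSum_blockCoef hω (Finset.Icc j (n + j - 1))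
    have h2 := h1.update i 0
    rw [zero_sub, neg_add_eq_sub] at h2
    refine h2.congr fun F => ?_
    rw [← Finset.sum_erase F (a := i) (Function.update_self _ _ _)]
    exact Finset.sum_congr rfl fun l hl => Function.update_of_ne (Finset.ne_of_mem_erase hl) _ _
  have hae := hZ.ae_summable hA
  have hle : P.real {ω | u < ‖Z i ω‖ ∧ ∃ j ∈ Finset.Icc (0 : ℤ) n,
        t < ‖blockSum A Z j n ω - B j i (Z i ω)‖} ≤ P.real ({ω | u < ‖Z i ω‖} ∩ D) := by
    refine ENNReal.toReal_mono (measure_ne_top _ _) (measure_mono_ae ?_)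
    filter_upwards [hae] with ω hω hω'
    obtain ⟨h1, j, hj, h2⟩ := hω'
    obtain ⟨F, hF⟩ := eventually_atTop.1
      ((hrest ω hω j).norm.eventually (lt_mem_nhds h2))
    refine ⟨h1, Set.mem_iUnion₂.2 ⟨j, hj, Set.mem_iUnion.2 ⟨F, ?_⟩⟩⟩
    exact Set.mem_iInter₂.2 fun F' hF' => hF F' hF'
  have hD : P.real D ≤ P.real {ω | ∃ j ∈ Finset.Icc (0 : ℤ) n, t / 3 < ‖blockSum A Z j n ω‖} +
      tailProb P (Z 0) (t / (3 * totalWeight A)) := by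
    rw [← hZ.prob_norm_gt i]
    refine le_trans ?_ (measureReal_union_le _ _)
    refine ENNReal.toReal_mono (measure_ne_top _ _) (measure_mono_ae ?_)
    filter_upwards [hae] with ω hω hω'
    obtain ⟨j, hj, hω'⟩ := Set.mem_iUnion₂.1 hω'
    obtain ⟨F, hF⟩ := Set.mem_iUnion.1 hω'
    have h3 : t ≤ ‖blockSum A Z j n ω - B j i (Z i ω)‖ :=
      ge_of_tendsto (hrest ω hω j).norm (eventually_atTop.2
        ⟨F, fun F' hF' => le_of_lt (Set.mem_iInter₂.1 hF F' hF')⟩)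
    -- If the full sum is at most `t / 3`, the removed term has norm at least `2t / 3`, so `Z i`
    -- itself is large.
    by_cases h4 : t / 3 < ‖blockSum A Z j n ω‖
    · exact Or.inl ⟨j, hj, h4⟩
    · refine Or.inr ?_
      have h5 : ‖B j i (Z i ω)‖ ≤ totalWeight A * ‖Z i ω‖ :=
        (B j i).le_of_opNorm_le ((norm_blockCoef_le subset_rfl i).trans
          (windowCoef_le_totalWeight hA j n i)) _
      have h6 := norm_sub_le (blockSum A Z j n ω) (B j i (Z i ω))
      change t / (3 * totalWeight A) < ‖Z i ω‖
      rw [div_lt_iff₀ (by positivity)]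
      linarith
  refine hle.trans ?_
  have h7 : P.real ({ω | u < ‖Z i ω‖} ∩ D) = tailProb P (Z 0) u * P.real D := by
    rw [← hZ.prob_norm_gt i, Measure.real, hind, ENNReal.toReal_mul]
    rfl
  rw [h7]
  exact mul_le_mul_of_nonneg_left hD (tailProb_nonneg _ _ _)

end Independence

/-! ### Convergence of block coefficients to the total sum -/

section Coefficients

variable {d : ℕ} {A : ℤ → Matrix (Fin d) (Fin d) ℝ}

lemma hasSum_act (hA : Summable fun i => ‖act (A i)‖) :
    HasSum (fun i => act (A i)) (act (coeffSum A)) := by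
  let e : Matrix (Fin d) (Fin d) ℝ ≃L[ℝ] (Vec d →L[ℝ] Vec d) :=
    (Matrix.toEuclideanCLM (n := Fin d) (𝕜 := ℝ)).toAlgEquiv.toLinearEquiv.toContinuousLinearEquiv
  have h1 : Summable fun i => act (A i) := hA.of_norm
  have h2 : act (coeffSum A) = ∑' i, act (A i) := e.map_tsum
  rw [h2]
  exact h1.hasSum

/-- For indices away from the ends of the window, the coefficient is close to the total sum. -/
lemma exists_norm_sub_blockCoef_le (hA : Summable fun i => ‖act (A i)‖) {ε : ℝ} (hε : 0 < ε) :
    ∃ m : ℕ, ∀ (j i : ℤ) (n : ℕ), j + m ≤ i → i + m ≤ n + j - 1 →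
      ‖act (coeffSum A) - blockCoef A (Finset.Icc j (n + j - 1)) i‖ ≤ ε := by
  obtain ⟨s, hs⟩ := eventually_atTop.1
    ((hasSum_act hA).eventually (Metric.closedBall_mem_nhds _ hε))
  -- A margin `m` at both ends makes the shifted block contain the finite set `s` beyond which
  -- partial sums are `ε`-close.
  obtain ⟨m, hm⟩ : ∃ m : ℕ, ∀ x ∈ s, x.natAbs ≤ m :=
    ⟨s.sup Int.natAbs, fun x hx => Finset.le_sup (f := Int.natAbs) hx⟩
  refine ⟨m, fun j i n h1 h2 => ?_⟩
  have h3 : s ⊆ Finset.Icc (j - i) (n + j - 1 - i) := fun x hx => by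
    have := hm x hx
    rw [Finset.mem_Icc]; omega
  have h4 := hs _ h3
  rw [dist_eq_norm, norm_sub_rev] at h4
  have h5 : blockCoef A (Finset.Icc j (n + j - 1)) i =
      ∑ k ∈ Finset.Icc (j - i) (n + j - 1 - i), act (A k) := by
    unfold blockCoef
    refine Finset.sum_bij' (fun k _ => k - i) (fun k _ => k + i) ?_ ?_ ?_ ?_ ?_
    all_goals intro k hk; simp only [Finset.mem_Icc] at *
    all_goals omega
  rwa [h5]

end Coefficients

/-! ### Disagreement about membership forces proximity to the frontier -/

section Frontier

lemma _root_.IsPreconnected.nonempty_inter_frontier {X : Type*} [TopologicalSpace X] {T S : Set X}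
    (hT : IsPreconnected T) (h1 : (T ∩ S).Nonempty) (h2 : (T ∩ Sᶜ).Nonempty) :
    (T ∩ frontier S).Nonempty := by
  by_contra h
  have hd : ∀ x ∈ T, x ∉ frontier S := fun x hx hxS => h ⟨x, hx, hxS⟩
  have hin : ∀ x ∈ T, x ∈ closure S → x ∈ interior S := fun x hx hxc => by
    by_contra hxi; exact hd x hx ⟨hxc, hxi⟩
  obtain ⟨x, hx, hxS⟩ := h1
  obtain ⟨y, hy, hyS⟩ := h2
  obtain ⟨z, -, hz1, hz2⟩ := hT (interior S) (closure S)ᶜ isOpen_interior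
    isClosed_closure.isOpen_compl
    (fun z hz => or_iff_not_imp_right.2 fun h' => hin z hz (not_not.1 h'))
    ⟨x, hx, hin x hx (subset_closure hxS)⟩
    ⟨y, hy, fun h' => hyS (interior_subset (hin y hy h'))⟩
  exact hz2 (interior_subset_closure hz1)

/-- The segment from `x` to `y` is connected and meets both `S` and its complement, so it crosses
the frontier within distance `‖x - y‖` of `x`. -/
lemma mem_cthickening_frontier {E : Type*} [NormedAddCommGroup E] [NormedSpace ℝ E] {S : Set E}
    {x y : E} {δ : ℝ} (hxy : ‖x - y‖ ≤ δ) (h : ¬(x ∈ S ↔ y ∈ S)) :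
    x ∈ Metric.cthickening δ (frontier S) := by
  have hc : IsPreconnected (segment ℝ x y) := (convex_segment x y).isPreconnected
  have hf : (segment ℝ x y ∩ frontier S).Nonempty := by
    by_cases hx : x ∈ S
    · have hy : y ∉ S := fun hy => h (iff_of_true hx hy)
      exact hc.nonempty_inter_frontier ⟨x, left_mem_segment _ _ _, hx⟩
        ⟨y, right_mem_segment _ _ _, hy⟩
    · have hy : y ∈ S := by by_contra hy; exact h (iff_of_false hx hy)
      exact hc.nonempty_inter_frontier ⟨y, right_mem_segment _ _ _, hy⟩
        ⟨x, left_mem_segment _ _ _, hx⟩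
  obtain ⟨z, hz, hzS⟩ := hf
  refine Metric.mem_cthickening_of_dist_le x z δ _ hzS ?_
  have h1 : dist x z ≤ dist x y := by
    obtain ⟨a, b, ha, hb, hab, rfl⟩ := hz
    have : x - (a • x + b • y) = b • (x - y) := by
      rw [← sub_eq_iff_eq_add.2 hab.symm, sub_smul, one_smul, smul_sub]
      abel
    rw [dist_eq_norm, dist_eq_norm, this, norm_smul, Real.norm_of_nonneg hb]
    exact mul_le_of_le_one_left (norm_nonneg _) (by linarith)
  exact h1.trans ((dist_eq_norm x y).trans_le hxy)

end Frontier

/-! ### Comparison of the two events -/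

section Main

variable {Ω : Type*} [MeasurableSpace Ω] {P : Measure Ω} [IsProbabilityMeasure P] {d : ℕ}
  {Z : ℤ → Ω → Vec d} {A : ℤ → Matrix (Fin d) (Fin d) ℝ} {ν : Measure (Punctured d)} {α : ℝ}

/-- If the events differ, then there is a large sum without a jump in its window, or there are two
jumps, a jump near an end, a huge jump, a jump with large remaining contributions, or a jump near
the boundary of the failure set. -/
lemma rareRun_symmDiff_bigJump_subset {Γ : Set (Vec d)} {θ δ₀ η M ε₁ δ₁ δ₂ : ℝ} {m n : ℕ}
    {B : Vec d →L[ℝ] Vec d} (hn : 1 ≤ n) (hθ₀ : 0 ≤ θ) (hθ₁ : θ < 1)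
    (hΓ : Γ ⊆ (Metric.closedBall 0 δ₀)ᶜ) (hη : η * ‖act (coeffSum A)‖ ≤ δ₀)
    (hB₁ : ∀ x, B (act (coeffSum A) x) = x) (hB₂ : ∀ x, act (coeffSum A) (B x) = x) (hε₁ : 0 ≤ ε₁)
    (hm : ∀ j i : ℤ, j + m ≤ i → i + m ≤ n + j - 1 →
      ‖act (coeffSum A) - blockCoef A (Finset.Icc j (n + j - 1)) i‖ ≤ ε₁)
    (hδ₂ : ‖B‖ * (ε₁ * M + δ₁) ≤ δ₂) :
    rareRun A Z Γ θ n ∆ bigJump A Z Γ θ n ⊆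
      (⋃ s ∈ ({0, ⌊n * θ⌋} : Finset ℤ), {ω | δ₀ * n < ‖blockSum A Z s n ω‖ ∧
        ∀ i ∈ Finset.Icc s (n + s - 1), ‖Z i ω‖ ≤ η * n}) ∪
      {ω | ∃ i ∈ Finset.Icc (0 : ℤ) (2 * n), ∃ l ∈ Finset.Icc (0 : ℤ) (2 * n), i ≠ l ∧
        η * n < ‖Z i ω‖ ∧ η * n < ‖Z l ω‖} ∪
      (⋃ i ∈ Finset.Ico ⌊n * θ⌋ (⌊n * θ⌋ + m) ∪ Finset.Ioc ((n : ℤ) - 1 - m) (n - 1),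
        {ω | η * n < ‖Z i ω‖}) ∪
      (⋃ i ∈ Finset.Ico (0 : ℤ) n, ({ω | M * n < ‖Z i ω‖} ∪
        {ω | η * n < ‖Z i ω‖ ∧ ∃ j ∈ Finset.Icc (0 : ℤ) n,
          δ₁ * n < ‖blockSum A Z j n ω - blockCoef A (Finset.Icc j (n + j - 1)) i (Z i ω)‖} ∪
        {ω | η ≤ ‖(n : ℝ)⁻¹ • Z i ω‖ ∧ ‖(n : ℝ)⁻¹ • Z i ω‖ ≤ M ∧ (n : ℝ)⁻¹ • Z i ω ∈
          Metric.cthickening δ₂ (frontier (act (coeffSum A) ⁻¹' Γ))})) := by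
  have hn0 : (0 : ℝ) < n := by exact_mod_cast hn
  set J := ⌊n * θ⌋ with hJ
  have hJ0 : 0 ≤ J := Int.floor_nonneg.2 (by positivity)
  have hJn : J < n := Int.floor_lt.2 (by push_cast; nlinarith)
  have hmem : ∀ x, x ∈ (n : ℝ) • Γ ↔ (n : ℝ)⁻¹ • x ∈ Γ := fun x =>
    Set.mem_smul_set_iff_inv_smul_mem₀ hn0.ne' _ _
  have hfar : ∀ x, x ∈ (n : ℝ) • Γ → δ₀ * n < ‖x‖ := fun x hx => by
    have := hΓ ((hmem x).1 hx)
    rw [Set.mem_compl_iff, mem_closedBall_zero_iff, not_le, norm_smul, norm_inv,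
      Real.norm_of_nonneg hn0.le, lt_inv_mul_iff₀ hn0] at this
    linarith
  intro ω hω
  by_contra hne
  simp only [Set.mem_union, not_or] at hne
  obtain ⟨⟨⟨h1, h2⟩, h3⟩, h4⟩ := hne
  have hrunJump : ∀ s ∈ ({0, J} : Finset ℤ), blockSum A Z s n ω ∈ (n : ℝ) • Γ →
      ∃ i ∈ Finset.Icc s (n + s - 1), η * n < ‖Z i ω‖ := fun s hs hsΓ => by
    by_contra! hno
    exact h1 (Set.mem_iUnion₂.2 ⟨s, hs, hfar _ hsΓ, hno⟩)
  -- Such an `i` lies in every block considered, at distance at least `m` from its ends, so one jump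
  -- decides all the blocks. A disagreement would put `Z i / n` near the frontier; errors are pulled
  -- back by `B` because the condition on `ν` concerns `𝒜⁻¹Γ`.
  have key : ∀ i, J ≤ i → i ≤ (n : ℤ) - 1 → η * n < ‖Z i ω‖ → ∀ j, 0 ≤ j → j ≤ J →
      (act (coeffSum A) (Z i ω) ∈ (n : ℝ) • Γ ↔ blockSum A Z j n ω ∈ (n : ℝ) • Γ) := by
    intro i hi1 hi2 hjump j hj0 hjJ
    have him : J + m ≤ i ∧ i + m ≤ n - 1 := by
      by_contra hcon
      refine h3 (Set.mem_iUnion₂.2 ⟨i, ?_, hjump⟩)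
      simp only [Finset.mem_union, Finset.mem_Ico, Finset.mem_Ioc]
      omega
    have h4' : ω ∉ _ := fun h => h4 (Set.mem_iUnion₂.2
      ⟨i, Finset.mem_Ico.2 ⟨by omega, by omega⟩, h⟩)
    simp only [Set.mem_union, not_or] at h4'
    obtain ⟨⟨h5, h6⟩, h7⟩ := h4'
    have hM : ‖Z i ω‖ ≤ M * n := not_lt.1 h5
    have hrest : ‖blockSum A Z j n ω - blockCoef A (Finset.Icc j (n + j - 1)) i (Z i ω)‖ ≤
        δ₁ * n := by
      by_contra! hlt
      exact h6 ⟨hjump, j, Finset.mem_Icc.2 ⟨hj0, by omega⟩, hlt⟩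
    by_contra hiff
    refine h7 ⟨?_, ?_, ?_⟩
    · rw [norm_smul, norm_inv, Real.norm_of_nonneg hn0.le, le_inv_mul_iff₀ hn0]; linarith
    · rw [norm_smul, norm_inv, Real.norm_of_nonneg hn0.le, inv_mul_le_iff₀ hn0]; linarith
    · refine mem_cthickening_frontier (y := (n : ℝ)⁻¹ • B (blockSum A Z j n ω)) ?_ ?_
      · have e : Z i ω - B (blockSum A Z j n ω) =
            B (act (coeffSum A) (Z i ω) - blockSum A Z j n ω) := by rw [map_sub, hB₁]
        have e' : act (coeffSum A) (Z i ω) - blockSum A Z j n ω =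
            (act (coeffSum A) - blockCoef A (Finset.Icc j (n + j - 1)) i) (Z i ω) -
            (blockSum A Z j n ω - blockCoef A (Finset.Icc j (n + j - 1)) i (Z i ω)) := by
          rw [sub_apply]; abel
        have h8 : ‖act (coeffSum A) (Z i ω) - blockSum A Z j n ω‖ ≤ (ε₁ * M + δ₁) * n := by
          rw [e']
          refine (norm_sub_le _ _).trans ?_
          have h9 := (act (coeffSum A) - blockCoef A (Finset.Icc j (n + j - 1)) i).le_of_opNorm_le
            (hm j i (by omega) (by omega)) (Z i ω)
          have h10 : ε₁ * ‖Z i ω‖ ≤ ε₁ * (M * n) := by gcongr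
          linarith
        rw [← smul_sub, norm_smul, norm_inv, Real.norm_of_nonneg hn0.le, inv_mul_le_iff₀ hn0, e]
        calc _ ≤ ‖B‖ * ((ε₁ * M + δ₁) * n) := B.le_opNorm_of_le h8
          _ = ‖B‖ * (ε₁ * M + δ₁) * n := by ring
          _ ≤ δ₂ * n := by gcongr
          _ = _ := mul_comm _ _
      · rwa [Set.mem_preimage, Set.mem_preimage, map_smul, map_smul, hB₂, ← hmem, ← hmem]
  rcases hω with ⟨hrun, hno⟩ | ⟨⟨i, hi1, hi2, hiΓ⟩, hno⟩
  -- Only the extreme blocks `j = 0` and `j = J` are used: they overlap in `[J, n - 1]`, and a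
  -- common jump must lie there.
  · obtain ⟨i, hi, hij⟩ := hrunJump 0 (by simp) (hrun 0 le_rfl (by push_cast; positivity))
    obtain ⟨l, hl, hlj⟩ := hrunJump J (by simp) (hrun J hJ0 (Int.floor_le _))
    rw [Finset.mem_Icc] at hi hl
    have hil : i = l := by
      by_contra hil
      exact h2 ⟨i, Finset.mem_Icc.2 (by omega), l, Finset.mem_Icc.2 (by omega), hil, hij, hlj⟩
    subst hil
    refine hno ⟨i, hl.1, by omega, (key i hl.1 (by omega) hij 0 le_rfl hJ0).2 ?_⟩
    exact hrun 0 le_rfl (by push_cast; positivity)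
  · refine hno fun j hj0 hj => (key i hi1 hi2 ?_ j hj0 (Int.le_floor.2 hj)).1 hiΓ
    have h5 : η * n * ‖act (coeffSum A)‖ < ‖Z i ω‖ * ‖act (coeffSum A)‖ := by
      calc η * n * ‖act (coeffSum A)‖ = η * ‖act (coeffSum A)‖ * n := by ring
        _ ≤ δ₀ * n := by gcongr
        _ < ‖act (coeffSum A) (Z i ω)‖ := hfar _ hiΓ
        _ ≤ _ := ((act (coeffSum A)).le_opNorm _).trans_eq (mul_comm _ _)
    exact lt_of_mul_lt_mul_right h5 (norm_nonneg _)

/-- The two events differ with probability of smaller order than `n P(‖Z₀‖ > n)`. -/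
lemma IsCenteredIID.eventually_prob_symmDiff_le (hZ : IsCenteredIID P Z)
    (hrv : RegularlyVarying P (Z 0) ν α) (hα : 1 < α) (hA : Summable fun i => ‖act (A i)‖)
    (hA_inv : IsUnit (coeffSum A)) {Γ : Set (Vec d)} (hΓ : IsFailureSet ν (coeffSum A) Γ)
    {θ : ℝ} (hθ₀ : 0 ≤ θ) (hθ₁ : θ < 1) {ε : ℝ} (hε : 0 < ε) :
    ∀ᶠ n : ℕ in atTop, P.real (rareRun A Z Γ θ n ∆ bigJump A Z Γ θ n) ≤
      7 * ε * (n * tailProb P (Z 0) n) := by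
  have ha := totalWeight_pos (A := A)
  obtain ⟨δ₀, hδ₀, hΓδ⟩ := hΓ.bounded_away
  obtain ⟨U, hU⟩ := hA_inv
  let B : Vec d →L[ℝ] Vec d := act (↑U⁻¹ : Matrix (Fin d) (Fin d) ℝ)
  have hB₁ : ∀ x, B (act (coeffSum A) x) = x := fun x => by
    have h : B * act (coeffSum A) = 1 := by
      rw [← hU, ← map_mul, Units.inv_mul, map_one]
    exact congrArg (fun f : Vec d →L[ℝ] Vec d => f x) h
  have hB₂ : ∀ x, act (coeffSum A) (B x) = x := fun x => by
    have h : act (coeffSum A) * B = 1 := by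
      rw [← hU, ← map_mul, Units.mul_inv, map_one]
    exact congrArg (fun f : Vec d →L[ℝ] Vec d => f x) h
  obtain ⟨η₀, hη₀, hE1⟩ := hZ.prob_no_jump_le hrv hα hA hδ₀
  obtain ⟨C, hC, hreg⟩ := hrv.tailProb_mul_le (hZ.meas 0)
  -- The second bound ensures that `𝒜 Z_i ∈ nΓ` already makes `Z_i` a jump. The constants are then
  -- chosen in the order `M`, `δ₂`, then `δ₁` and `ε₁`, which share `δ₂` equally after `B` is
  -- applied, and last `m`.
  set η := min η₀ (δ₀ / (‖act (coeffSum A)‖ + 1)) with hηdef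
  have hη : 0 < η := lt_min hη₀ (by positivity)
  have hηA : η * ‖act (coeffSum A)‖ ≤ δ₀ := by
    calc η * ‖act (coeffSum A)‖ ≤ δ₀ / (‖act (coeffSum A)‖ + 1) * (‖act (coeffSum A)‖ + 1) := by
          gcongr
          · exact min_le_right _ _
          · linarith
      _ = δ₀ := by field_simp
  set Cη := C * η ^ (-α) with hCη
  have hCη0 : 0 < Cη := by positivity
  obtain ⟨M, hM0, hMC⟩ : ∃ M : ℝ, 0 < M ∧ C * M ^ (-α) ≤ ε := by
    have h1 : Tendsto (fun M : ℝ => C * M ^ (-α)) atTop (𝓝 0) := by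
      simpa using (tendsto_rpow_neg_atTop (by linarith : 0 < α)).const_mul C
    exact ((eventually_gt_atTop 0).and (h1.eventually (ge_mem_nhds hε))).exists
  obtain ⟨δ₂, hδ₂, hE6⟩ := hrv.exists_prob_cthickening_le (hZ.meas 0)
    (isClosed_frontier (s := act (coeffSum A) ⁻¹' Γ)) hΓ.continuity hη hM0 hε
  set K := ‖B‖ + 1 with hK
  have hK0 : 0 < K := by positivity
  set δ₁ := δ₂ / (2 * K) with hδ₁def
  set ε₁ := δ₂ / (2 * K * M) with hε₁def
  have hδ₁ : 0 < δ₁ := by positivity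
  have hε₁ : 0 < ε₁ := by positivity
  have hK2 : ‖B‖ * (ε₁ * M + δ₁) ≤ δ₂ := by
    calc ‖B‖ * (ε₁ * M + δ₁) ≤ K * (ε₁ * M + δ₁) := by
          gcongr; rw [hK]; linarith
      _ = δ₂ := by rw [hε₁def, hδ₁def]; field_simp; norm_num
  obtain ⟨m, hm⟩ := exists_norm_sub_blockCoef_le hA hε₁
  have hcast := tendsto_natCast_atTop_atTop (R := ℝ)
  have hlim2 : Tendsto (fun n : ℕ => 9 * Cη * (n * tailProb P (Z 0) (η * n))) atTop (𝓝 0) := by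
    simpa using (tendsto_mul_tailProb (hZ.meas 0) hZ.integrable_zero hη).const_mul (9 * Cη)
  have hlim5 : Tendsto (fun n : ℕ => Cη *
      (P.real {ω | ∃ j ∈ Finset.Icc (0 : ℤ) n, δ₁ / 3 * n < ‖blockSum A Z j n ω‖} +
        n * tailProb P (Z 0) (δ₁ / (3 * totalWeight A) * n))) atTop (𝓝 0) := by
    simpa using ((hZ.tendsto_prob_max_blockSum hrv hα hA (show 0 < δ₁ / 3 by positivity)).add
      (tendsto_mul_tailProb (hZ.meas 0) hZ.integrable_zero
        (show 0 < δ₁ / (3 * totalWeight A) by positivity))).const_mul Cη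
  filter_upwards [eventually_ge_atTop 1, hE1 η (min_le_left _ _) ε hε,
    hcast.eventually (hreg η hη), hcast.eventually (hreg M hM0), hcast.eventually hE6,
    hlim2.eventually (ge_mem_nhds hε), hlim5.eventually (ge_mem_nhds hε),
    hcast.eventually_ge_atTop (2 * m * Cη / ε)] with n hn h1 hη1 hM1 h6 h2 h5 h3
  have hn1 : (1 : ℝ) ≤ n := by exact_mod_cast hn
  have hn0 : (0 : ℝ) < n := by linarith
  set p := tailProb P (Z 0) n with hp
  have hp0 : 0 ≤ p := tailProb_nonneg _ _ _
  have hpη0 : 0 ≤ tailProb P (Z 0) (η * n) := tailProb_nonneg _ _ _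
  refine (measureReal_mono (rareRun_symmDiff_bigJump_subset hn hθ₀ hθ₁ hΓδ hηA hB₁ hB₂ hε₁.le
    (fun j i => hm j i n) hK2) (measure_ne_top _ _)).trans ?_
  -- The seven `ε` are: two for the extreme blocks, one for two jumps, one for jumps near the ends,
  -- and three for the events attached to each index.
  refine (measureReal_union_le _ _).trans ((add_le_add ((measureReal_union_le _ _).trans
    (add_le_add ((measureReal_union_le _ _).trans (add_le_add
      (b := 2 * ε * (n * p)) (d := ε * (n * p)) ?_ ?_)) (?_ : _ ≤ ε * (n * p))))
      (?_ : _ ≤ 3 * ε * (n * p))).trans_eq (by ring))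
  · refine (measureReal_biUnion_finset_le _ _).trans ?_
    refine (Finset.sum_le_sum fun s _ => h1 s).trans ?_
    rw [Finset.sum_const, nsmul_eq_mul]
    have hc : ((({0, ⌊n * θ⌋} : Finset ℤ).card : ℕ) : ℝ) ≤ 2 := by
      exact_mod_cast Finset.card_le_two
    calc _ ≤ 2 * (ε * (n * p)) := by gcongr
      _ = _ := by ring
  · refine (hZ.prob_two_jumps_le _ _).trans ?_
    have hc : (((Finset.Icc (0 : ℤ) (2 * n)).card : ℕ) : ℝ) ≤ 3 * n := by
      have : (Finset.Icc (0 : ℤ) (2 * n)).card ≤ 3 * n := by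
        rw [Int.card_Icc]; omega
      exact_mod_cast this
    calc _ ≤ (3 * n * tailProb P (Z 0) (η * n)) * (3 * n * (Cη * p)) := by gcongr
      _ = 9 * Cη * (n * tailProb P (Z 0) (η * n)) * (n * p) := by ring
      _ ≤ _ := by gcongr
  · refine (measureReal_biUnion_finset_le _ _).trans ?_
    rw [Finset.sum_congr rfl fun i _ => hZ.prob_norm_gt i _, Finset.sum_const, nsmul_eq_mul]
    have hc : (((Finset.Ico ⌊n * θ⌋ (⌊n * θ⌋ + m) ∪
        Finset.Ioc ((n : ℤ) - 1 - m) (n - 1)).card : ℕ) : ℝ) ≤ 2 * m := by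
      have : (Finset.Ico ⌊n * θ⌋ (⌊n * θ⌋ + m) ∪
          Finset.Ioc ((n : ℤ) - 1 - m) (n - 1)).card ≤ 2 * m := by
        refine (Finset.card_union_le _ _).trans ?_
        rw [Int.card_Ico, Int.card_Ioc]; omega
      exact_mod_cast this
    rw [div_le_iff₀ hε] at h3
    calc _ ≤ 2 * m * (Cη * p) := by gcongr
      _ = 2 * m * Cη * p := by ring
      _ ≤ n * ε * p := by gcongr
      _ = _ := by ring
  · refine (measureReal_biUnion_finset_le _ _).trans ?_
    have hterm : ∀ i ∈ Finset.Ico (0 : ℤ) n, P.real ({ω | M * n < ‖Z i ω‖} ∪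
        {ω | η * n < ‖Z i ω‖ ∧ ∃ j ∈ Finset.Icc (0 : ℤ) n,
          δ₁ * n < ‖blockSum A Z j n ω - blockCoef A (Finset.Icc j (n + j - 1)) i (Z i ω)‖} ∪
        {ω | η ≤ ‖(n : ℝ)⁻¹ • Z i ω‖ ∧ ‖(n : ℝ)⁻¹ • Z i ω‖ ≤ M ∧ (n : ℝ)⁻¹ • Z i ω ∈
          Metric.cthickening δ₂ (frontier (act (coeffSum A) ⁻¹' Γ))}) ≤ 3 * ε * p := by
      intro i _
      refine (measureReal_union_le _ _).trans ((add_le_add ((measureReal_union_le _ _).trans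
        (add_le_add (b := ε * p) (d := ε * p) ?_ ?_)) (?_ : _ ≤ ε * p)).trans_eq (by ring))
      · rw [hZ.prob_norm_gt]
        exact hM1.trans (by gcongr)
      · refine (hZ.prob_jump_and_rest_le hA i n (by positivity)).trans ?_
        have e1 : δ₁ * n / 3 = δ₁ / 3 * n := by ring
        have e2 : δ₁ * n / (3 * totalWeight A) = δ₁ / (3 * totalWeight A) * n := by ring
        rw [e1, e2]
        have hq0 := tailProb_nonneg P (Z 0) (δ₁ / (3 * totalWeight A) * n)
        calc _ ≤ (Cη * p) *
              (P.real {ω | ∃ j ∈ Finset.Icc (0 : ℤ) n, δ₁ / 3 * n < ‖blockSum A Z j n ω‖} +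
                n * tailProb P (Z 0) (δ₁ / (3 * totalWeight A) * n)) := by
              gcongr
              -- The extra factor `n` is harmless and brings the term into the form of
              -- `tendsto_mul_tailProb`.
              exact le_mul_of_one_le_left hq0 hn1
          _ = Cη * (P.real {ω | ∃ j ∈ Finset.Icc (0 : ℤ) n, δ₁ / 3 * n < ‖blockSum A Z j n ω‖} +
                n * tailProb P (Z 0) (δ₁ / (3 * totalWeight A) * n)) * p := by ring
          _ ≤ _ := by gcongr
      · refine le_of_eq_of_le ?_ h6
        refine hZ.prob_mem i (S := {x | η ≤ ‖(n : ℝ)⁻¹ • x‖ ∧ ‖(n : ℝ)⁻¹ • x‖ ≤ M ∧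
          (n : ℝ)⁻¹ • x ∈ Metric.cthickening δ₂ (frontier (act (coeffSum A) ⁻¹' Γ))}) ?_
        have hc : Continuous fun x : Vec d => (n : ℝ)⁻¹ • x := continuous_const_smul _
        exact ((isClosed_le continuous_const hc.norm).inter ((isClosed_le hc.norm
          continuous_const).inter (Metric.isClosed_cthickening.preimage hc))).measurableSet
    refine (Finset.sum_le_sum hterm).trans_eq ?_
    rw [Finset.sum_const, nsmul_eq_mul, Int.card_Ico]
    simp
    ring

/-- The scaled failure set has probability at least of the order of the norm tail. -/
lemma IsFailureSet.exists_le_prob {M : Matrix (Fin d) (Fin d) ℝ} {Γ : Set (Vec d)}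
    (hΓ : IsFailureSet ν M Γ) {Y : Ω → Vec d} (hY : Measurable Y)
    (hrv : RegularlyVarying P Y ν α) :
    ∃ c > 0, ∀ᶠ n : ℕ in atTop,
      c * tailProb P Y n ≤ P.real {ω | act M (Y ω) ∈ (n : ℝ) • Γ} := by
  obtain ⟨δ₀, hδ₀, hΓδ⟩ := hΓ.bounded_away
  have h0 : (0 : Vec d) ∉ interior (act M ⁻¹' Γ) := fun h => by
    have := hΓδ (show act M 0 ∈ Γ from interior_subset (s := act M ⁻¹' Γ) h)
    rw [map_zero] at this
    exact this (Metric.mem_closedBall_self hδ₀.le)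
  -- Lower bounds from vague convergence need an open set; since the frontier is null, the interior
  -- keeps all the mass.
  have hpos : 0 < ν (inPunctured (interior (act M ⁻¹' Γ))) := by
    by_contra! hz
    refine hΓ.pos.ne' (measure_mono_null (t := inPunctured (interior (act M ⁻¹' Γ)) ∪
      inPunctured (frontier (act M ⁻¹' Γ))) ?_
      (measure_union_null (nonpos_iff_eq_zero.1 hz) hΓ.continuity))
    rintro x ⟨y, hy, e⟩
    by_cases hyi : y ∈ interior (act M ⁻¹' Γ)
    · exact Or.inl ⟨y, hyi, e⟩
    · exact Or.inr ⟨y, ⟨subset_closure hy, hyi⟩, e⟩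
  obtain ⟨c, hc, h⟩ := hrv.exists_le_prob_of_isOpen hY isOpen_interior h0 hpos
  refine ⟨c, hc, ?_⟩
  filter_upwards [(tendsto_natCast_atTop_atTop (R := ℝ)).eventually h, eventually_ge_atTop 1]
    with n hn hn1
  have hn0 : (n : ℝ) ≠ 0 := by positivity
  refine hn.trans (measureReal_mono fun ω hω => ?_)
  have h1 := interior_subset hω
  rw [Set.mem_preimage, map_smul] at h1
  exact (Set.mem_smul_set_iff_inv_smul_mem₀ hn0 _ _).2 h1

end Main

end MovingAverage

theorem corollary1 {Ω : Type*} [MeasurableSpace Ω] (P : Measure Ω) [IsProbabilityMeasure P]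
    (d : ℕ) (hd : 1 ≤ d)
    (Z : ℤ → Ω → MovingAverage.Vec d) (hZ_meas : ∀ i, Measurable (Z i))
    (hZ_indep : iIndepFun Z P) (hZ_ident : ∀ i, IdentDistrib (Z i) (Z 0) P P)
    (hZ_int : Integrable (Z 0) P) (hZ_mean : ∫ ω, Z 0 ω ∂P = 0)
    (α : ℝ) (hα : 1 < α) (ν : Measure (MovingAverage.Punctured d))
    (hZ_rv : MovingAverage.RegularlyVarying P (Z 0) ν α)
    (A : ℤ → Matrix (Fin d) (Fin d) ℝ)
    (hA_summable : Summable fun i => ‖MovingAverage.act (A i)‖)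
    (hA_inv : IsUnit (MovingAverage.coeffSum A))
    (Γ : Set (MovingAverage.Vec d))
    (hΓ : MovingAverage.IsFailureSet ν (MovingAverage.coeffSum A) Γ)
    (θ : ℝ) (hθ₀ : 0 ≤ θ) (hθ₁ : θ < 1) :
    (∀ k : ℤ, ∀ᵐ ω ∂P, Summable fun i : ℤ => MovingAverage.act (A i) (Z (k - i) ω)) ∧
    (∀ᶠ n : ℕ in atTop,
      0 < P.real {ω | MovingAverage.act (MovingAverage.coeffSum A) (Z 0 ω) ∈ (n : ℝ) • Γ}) ∧
    Tendsto
      (fun n : ℕ =>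
        P.real (MovingAverage.rareRun A Z Γ θ n ∆ MovingAverage.bigJump A Z Γ θ n) /
          (n * P.real
            {ω | MovingAverage.act (MovingAverage.coeffSum A) (Z 0 ω) ∈ (n : ℝ) • Γ}))
      atTop (𝓝 0) := by
  have hZ : MovingAverage.IsCenteredIID P Z := ⟨hZ_meas, hZ_indep, hZ_ident, hZ_int, hZ_mean⟩
  obtain ⟨c, hc, hlow⟩ := hΓ.exists_le_prob (hZ_meas 0) hZ_rv
  refine ⟨fun k => ?_, ?_, ?_⟩
  · filter_upwards [hZ.ae_summable hA_summable] with ω hω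
    exact (hω k).of_norm_bounded fun i => (MovingAverage.act (A i)).le_opNorm _
  · filter_upwards [hlow] with n hn
    exact (mul_pos hc (hZ_rv.tailProb_pos n)).trans_le hn
  · refine tendsto_order.2 ⟨fun b hb => Eventually.of_forall fun n => hb.trans_le (by positivity),
      fun b hb => ?_⟩
    filter_upwards [hZ.eventually_prob_symmDiff_le hZ_rv hα hA_summable hA_inv hΓ hθ₀ hθ₁
      -- Seven times `b / 14` is `b / 2`, and `c` converts the norm tail into the probability of the
      -- failure set.
      (show 0 < b / 14 * c by positivity), hlow, eventually_ge_atTop 1] with n h1 h2 hn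
    have hn0 : (0 : ℝ) < n := by exact_mod_cast hn
    have hp := hZ_rv.tailProb_pos n
    have hq := (mul_pos hc hp).trans_le h2
    refine lt_of_le_of_lt (b := b / 2) ?_ (half_lt_self hb)
    rw [div_le_iff₀ (mul_pos hn0 hq)]
    calc _ ≤ _ := h1
      _ = b / 2 * (n * (c * MovingAverage.tailProb P (Z 0) n)) := by ring
      _ ≤ _ := by gcongr
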